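/- Setting. Let $(\mathcal X,d)$ be a compact metric space and let $k$ be a covariance function on $\mathcal X$ with $k(x,x)\le K$ for all $x$ and canonical metric $d_k(x,y)=(k(x,x)+k(y,y)-2k(x,y))^{1/2}$. Assume that $d_k(x,y)\le g(d(x,y))$ for a non-decreasing continuous $g:[0,\infty)\to[0,\infty)$ with $g(0)=0$, and that $g(r)\le C_k r^{\alpha}$ for $0\le r\le\delta_k$, where $\delta_k,C_k>0$ and $0<\alpha\le1$. Let $(x_{h,i})_{h\ge0,\,1\le i\le 2^h}$, with cells $\mathcal X_{h,i}$, be a tree of partitions: for every $h$ the $2^h$ points $x_{h,i}$ are distinct, $\bigcup_i\mathcal X_{h,i}=\mathcal X$, $\mathcal X_{h+1,2i-1}\cup\mathcal X_{h+1,2i}=\mathcal X_{h,i}$, and $B(x_{h,i},v_2\rho^h)\subset\mathcal X_{h,i}\subset B(x_{h,i},v_1\rho^h)$ for constants $0<v_2\le1\le v_1$, $0<\rho<1$. Let $\mathrm{vol}$ be a finite Borel measure on $\mathcal X$ (the reference measure for uniform sampling) such that, for each $h$ and each $0<r\le v_2\rho^h$, the balls $B(x_{h,i},r)$, $1\le i\le2^h$,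 all have the same positive measure. Algorithm. Let $f$ be a sample from $GP(0,k)$; an evaluation at $x$ in iteration $t$ returns $f(x)+\eta_t$, where the $\eta_t\sim N(0,\sigma^2)$ are independent of each other and of $f$, $\sigma>0$. Given a budget $n$, a threshold $\tau$ and parameters $\beta$, $(V_h)_{h\ge 0}$ and $h_{\max}\ge1$ (arbitrary real numbers, in particular the usual choices depending on $n$ and on a confidence level), the algorithm starts with the single active node $(0,1)$ and repeats the following as long as fewer than $n$ evaluations have been made and active nodes are left. Let $\mu,s$ denote the posterior mean and standard deviation given all evaluations made so far. For a node $v=(h,i)$ with parent $p$ put $u(v)=\min\{\mu(x_v)+\beta s(x_v),\ \mu(x_p)+\beta s(x_p)+V_{h-1}\}+V_h$ and $l(v)=\max\{\mu(x_v)-\beta s(x_v),\ \mu(x_p)-\beta s(x_p)-V_{h-1}\}-V_h$ (without the terms in $p$ at the root), and let $\bar u,\bar l$ be the running minimum of $u$ and the running maximum of $l$ over the iterations so far. Active nodes with $\bar l\ge\tau$ are accepted, those with $\bar l<\tau$ and $\bar u<\tau$ are rejected, and both are removed. Among the remaining nodes one, $(h,i)$, that maximizes $\max(\bar u-\tau,\tau-\bar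 l)$ is selected (ties are broken arbitrarily). If $\beta s(x_{h,i})<V_h$ and $h\le h_{\max}$, it is replaced by its two children; otherwise the function is evaluated at $x_{h,i}$. Notation. Consider the algorithm after any fixed number of iterations (for a large number, the completed run). Let $n_h$ be the number of evaluations at points of depth $h$, and let $J_n$ be the sum, over all evaluations, of the posterior variance of the evaluated point given all earlier evaluations. For $0<\delta<1$ let $m_h=\lceil 2^h\log(2^hh_{\max}/\delta)\rceil$. For each $h$ with $n_h\ge1$ draw, given $n_h$, $m_h$ independent points uniformly (with respect to $\mathrm{vol}$) from $\mathcal Z_h=\bigcup_i B(x_{h,i},\epsilon_h)$, $\epsilon_h=\min\{v_2\rho^h,1/n_h\}$, and let $\hat\lambda_1\ge\dots\ge\hat\lambda_{m_h}$ be the eigenvalues of their covariance matrix, whose entries are the values of $k$ at the pairs of these points. For $1\le T_h\le n_h$ let $$\mathcal I_h(n_h,T_h)=\max_{1\le s\le n_h}\Big(T_h\log\frac{s\,m_h}{\sigma^2}+\sigma^{-2}(n_h-s)\sum_{i=T_h+1}^{m_h}\hat\lambda_i\Big).$$ Theorem. There are constants $C_1,C_2>0$, depending only on $\sigma,K,\delta_k,C_k,\alpha$,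 such that with probability at least $1-\delta$, simultaneously for all choices of $T_h\in\{1,\dots,n_h\}$, $$J_n\le C_1\sum_{h:\,n_h\ge1}\Big(\mathcal I_h(n_h,T_h)+C_2\max\{1,\,n_h^{1-2\alpha}\}\Big).$$ In particular, the remainder in each summand is $O(1)$ whenever $\alpha\ge1/2$ (for instance for every kernel that is Lipschitz with respect to $d$). -/

import Mathlib

open MeasureTheory ProbabilityTheory

namespace LevelSet

noncomputable section

/-! ### Covariance functions and Gaussian process regression -/

/-- A covariance function on `X`: a symmetric positive semidefinite real kernel. -/
structure CovKernel (X : Type*) where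
  toFun : X → X → ℝ
  symm : ∀ x y, toFun x y = toFun y x
  posSemidef : ∀ (m : ℕ) (x : Fin m → X) (c : Fin m → ℝ),
    0 ≤ ∑ i, ∑ j, c i * c j * toFun (x i) (x j)

namespace CovKernel

variable {X : Type*}

/-- The canonical (pseudo)metric of the kernel,
`d_k(x, y) = (k(x,x) + k(y,y) - 2 k(x,y))^{1/2}`. -/
def canonicalDist (k : CovKernel X) (x y : X) : ℝ :=
  Real.sqrt (k.toFun x x + k.toFun y y - 2 * k.toFun x y)

/-- The covariance matrix `(k(p_i, p_j))_{i,j}` of a finite family of points. -/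
def gram (k : CovKernel X) {m : ℕ} (p : Fin m → X) : Matrix (Fin m) (Fin m) ℝ :=
  Matrix.of fun i j => k.toFun (p i) (p j)

theorem gram_isHermitian (k : CovKernel X) {m : ℕ} (p : Fin m → X) :
    (k.gram p).IsHermitian := by
  ext i j
  simp [gram, k.symm (p i) (p j)]

/-- The posterior mean at `x` after observing the values `y` at the points `p`, under noise of
variance `σ ^ 2`. -/
def posteriorMean (k : CovKernel X) (σ : ℝ) {m : ℕ} (p : Fin m → X) (y : Fin m → ℝ) (x : X) : ℝ :=
  (fun i => k.toFun x (p i)) ⬝ᵥ (Matrix.mulVec (k.gram p + σ ^ 2 • 1)⁻¹ y)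

/-- The posterior variance at `x` after observations at the points `p`. -/
def posteriorVar (k : CovKernel X) (σ : ℝ) {m : ℕ} (p : Fin m → X) (x : X) : ℝ :=
  k.toFun x x -
    (fun i => k.toFun x (p i)) ⬝ᵥ
      (Matrix.mulVec (k.gram p + σ ^ 2 • 1)⁻¹ (fun i => k.toFun (p i) x))

/-- The sum `∑_{i = T + 1}^{m} λ̂_i`, where `λ̂_1 ≥ ... ≥ λ̂_m` are the eigenvalues of the covariance
matrix of the `m` points `p` (Mathlib's `eigenvalues₀` lists them in decreasing order, indexed
from `0`). -/
def tailEigenvalueSum (k : CovKernel X) {m : ℕ} (p : Fin m → X) (T : ℕ) : ℝ :=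
  ∑ i : Fin (Fintype.card (Fin m)),
    if T ≤ i.1 then (k.gram_isHermitian p).eigenvalues₀ i else 0

/-- `max_{1 ≤ s ≤ c} (T log(s m / σ²) + σ⁻² (c - s) ∑_{i = T + 1}^{m} λ̂_i)`, where `m` is the number
of the points `p` and `λ̂_i` are the ordered eigenvalues of their covariance matrix.
Meaningful for `1 ≤ c`. -/
def infoTerm (k : CovKernel X) (σ : ℝ) {m : ℕ} (p : Fin m → X) (c T : ℕ) : ℝ :=
  ⨆ s : Set.Icc 1 c,
    ((T : ℝ) * Real.log (((s : ℕ) : ℝ) * (m : ℝ) / σ ^ 2) +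
      (σ ^ 2)⁻¹ * ((c : ℝ) - ((s : ℕ) : ℝ)) * k.tailEigenvalueSum p T)

end CovKernel

/-! ### Trees of partitions -/

/-- The nodes `(h, i)` of the infinite binary tree; the index `i` runs through `0, ..., 2 ^ h - 1`. -/
abbrev Node : Type := (h : ℕ) × Fin (2 ^ h)

/-- The root of the tree. -/
def root : Node := ⟨0, ⟨0, by norm_num⟩⟩

/-- The first child `(h + 1, 2 i)` of `(h, i)`. -/
def leftChild (v : Node) : Node :=
  ⟨v.1 + 1, ⟨2 * v.2.1, by have := v.2.2; rw [pow_succ]; omega⟩⟩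

/-- The second child `(h + 1, 2 i + 1)` of `(h, i)`. -/
def rightChild (v : Node) : Node :=
  ⟨v.1 + 1, ⟨2 * v.2.1 + 1, by have := v.2.2; rw [pow_succ]; omega⟩⟩

/-- The parent of a node; the root has none. -/
def parent : Node → Option Node
  | ⟨0, _⟩ => none
  | ⟨h + 1, i⟩ => some ⟨h, ⟨i.1 / 2, by
      have h1 := i.2
      have h2 : 2 ^ (h + 1) = 2 ^ h * 2 := pow_succ 2 h
      omega⟩⟩

/-- A tree of partitions of the metric space `X`, with its geometric parameters. -/
structure PartitionTree (X : Type*) [MetricSpace X] where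
  /-- the point of a node -/
  pt : Node → X
  /-- the cell of a node -/
  cell : Node → Set X
  v₁ : ℝ
  v₂ : ℝ
  ρ : ℝ
  v₂_pos : 0 < v₂
  v₂_le : v₂ ≤ 1
  le_v₁ : 1 ≤ v₁
  ρ_pos : 0 < ρ
  ρ_lt : ρ < 1
  /-- there are `2 ^ h` different points at depth `h` -/
  pt_injective : ∀ h : ℕ, Function.Injective fun i : Fin (2 ^ h) => pt ⟨h, i⟩
  iUnion_cell : ∀ h : ℕ, ⋃ i : Fin (2 ^ h), cell ⟨h, i⟩ = Set.univ
  cell_children : ∀ v, cell (leftChild v) ∪ cell (rightChild v) = cell v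
  ball_subset_cell : ∀ v, Metric.ball (pt v) (v₂ * ρ ^ v.1) ⊆ cell v
  cell_subset_ball : ∀ v, cell v ⊆ Metric.ball (pt v) (v₁ * ρ ^ v.1)

namespace PartitionTree

variable {X : Type*} [MetricSpace X]

/-- The radius `ε_h = min (v₂ ρ^h, 1 / c)`, where `c` is the number of evaluations at depth `h`. -/
def radius (tree : PartitionTree X) (h c : ℕ) : ℝ :=
  min (tree.v₂ * tree.ρ ^ h) (1 / (c : ℝ))

/-- The union of the balls of radius `ε_h` around the points of depth `h`. -/
def neighborhood (tree : PartitionTree X) (h c : ℕ) : Set X :=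
  ⋃ i : Fin (2 ^ h), Metric.ball (tree.pt ⟨h, i⟩) (tree.radius h c)

/-- The reference measure, with respect to which points are sampled uniformly, gives the same
positive mass to all balls of equal radius at most `v₂ ρ^h` around the points of depth `h`. -/
def BallsEquallyLarge [MeasurableSpace X] (tree : PartitionTree X) (vol : Measure X) : Prop :=
  ∀ (h : ℕ) (r : ℝ), 0 < r → r ≤ tree.v₂ * tree.ρ ^ h →
    ∀ i j : Fin (2 ^ h),
      0 < vol (Metric.ball (tree.pt ⟨h, i⟩) r) ∧
      vol (Metric.ball (tree.pt ⟨h, i⟩) r) = vol (Metric.ball (tree.pt ⟨h, j⟩) r)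

end PartitionTree

/-! ### The algorithm -/

/-- The parameters of the algorithm: the budget, the threshold, the width of the confidence
intervals, the bounds on the variation of the function in the cells, and the maximal depth. -/
structure Params where
  n : ℕ
  τ : ℝ
  β : ℝ
  V : ℕ → ℝ
  hmax : ℝ

/-- A record of the evaluations made so far, the oldest first: evaluated nodes and observed values. -/
abbrev Record : Type := List (Node × ℝ)

namespace Record

variable {X : Type*} [MetricSpace X]

/-- Posterior mean at `x` given the record. -/
def mean (k : CovKernel X) (σ : ℝ) (tree : PartitionTree X) (L : Record) (x : X) : ℝ :=
  k.posteriorMean σ (fun i : Fin L.length => tree.pt (L.get i).1)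
    (fun i : Fin L.length => (L.get i).2) x

/-- Posterior variance at `x` given the record. -/
def var (k : CovKernel X) (σ : ℝ) (tree : PartitionTree X) (L : Record) (x : X) : ℝ :=
  k.posteriorVar σ (fun i : Fin L.length => tree.pt (L.get i).1) x

/-- Posterior standard deviation at `x` given the record. -/
def std (k : CovKernel X) (σ : ℝ) (tree : PartitionTree X) (L : Record) (x : X) : ℝ :=
  Real.sqrt (var k σ tree L x)

/-- The lower bound `l_t` on the function in the cell of `v`, given the record. -/
def lower (k : CovKernel X) (σ : ℝ) (tree : PartitionTree X) (prm : Params) (L : Record)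
    (v : Node) : ℝ :=
  match parent v with
  | none =>
      (mean k σ tree L (tree.pt v) - prm.β * std k σ tree L (tree.pt v)) - prm.V v.1
  | some w =>
      max (mean k σ tree L (tree.pt v) - prm.β * std k σ tree L (tree.pt v))
        (mean k σ tree L (tree.pt w) - prm.β * std k σ tree L (tree.pt w) - prm.V w.1) - prm.V v.1

/-- The upper bound `u_t` on the function in the cell of `v`, given the record. -/
def upper (k : CovKernel X) (σ : ℝ) (tree : PartitionTree X) (prm : Params) (L : Record)
    (v : Node) : ℝ :=
  match parent v with
  | none =>
      (mean k σ tree L (tree.pt v) + prm.β * std k σ tree L (tree.pt v)) + prm.V v.1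
  | some w =>
      min (mean k σ tree L (tree.pt v) + prm.β * std k σ tree L (tree.pt v))
        (mean k σ tree L (tree.pt w) + prm.β * std k σ tree L (tree.pt w) + prm.V w.1) + prm.V v.1

/-- `n_h`: the number of evaluations at points of depth `h`. -/
def evalCount (L : Record) (h : ℕ) : ℕ :=
  L.countP fun e => e.1.1 = h

/-- `J_n`: the sum, over the evaluations in the record, of the posterior variance of the evaluated
point given all earlier evaluations. -/
def sumVar (k : CovKernel X) (σ : ℝ) (tree : PartitionTree X) (L : Record) : ℝ :=
  ∑ j : Fin L.length, var k σ tree (L.take j) (tree.pt (L.get j).1)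

end Record

/-- A run of the algorithm, iterations counted from `0`. Here `active t`, `record t`, `Shat t`,
`Rhat t` are the active nodes, the evaluations made and the accepted and rejected regions at the
start of iteration `t`, and `sel t` is the node selected in iteration `t`. -/
structure Trace (X : Type*) where
  active : ℕ → Finset Node
  record : ℕ → Record
  sel : ℕ → Node
  Shat : ℕ → Set X
  Rhat : ℕ → Set X

namespace Trace

variable {X : Type*} [MetricSpace X]

/-- The running lower bound (the maximum of the bounds `l_s` for `s ≤ t`). -/
def lbar (k : CovKernel X) (σ : ℝ) (tree : PartitionTree X) (prm : Params) (tr : Trace X)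
    (t : ℕ) (v : Node) : ℝ :=
  (Finset.range (t + 1)).sup' Finset.nonempty_range_add_one
    fun s => (tr.record s).lower k σ tree prm v

/-- The running upper bound (the minimum of the bounds `u_s` for `s ≤ t`). -/
def ubar (k : CovKernel X) (σ : ℝ) (tree : PartitionTree X) (prm : Params) (tr : Trace X)
    (t : ℕ) (v : Node) : ℝ :=
  (Finset.range (t + 1)).inf' Finset.nonempty_range_add_one
    fun s => (tr.record s).upper k σ tree prm v

open Classical in
/-- The active nodes that iteration `t` neither accepts nor rejects. -/
def remaining (k : CovKernel X) (σ : ℝ) (tree : PartitionTree X) (prm : Params) (tr : Trace X)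
    (t : ℕ) : Finset Node :=
  (tr.active t).filter fun v =>
    ¬ prm.τ ≤ tr.lbar k σ tree prm t v ∧ ¬ tr.ubar k σ tree prm t v < prm.τ

/-- The selection index `max (ū_t - τ, τ - l̄_t)`. -/
def index (k : CovKernel X) (σ : ℝ) (tree : PartitionTree X) (prm : Params) (tr : Trace X)
    (t : ℕ) (v : Node) : ℝ :=
  max (tr.ubar k σ tree prm t v - prm.τ) (prm.τ - tr.lbar k σ tree prm t v)

/-- The selected node is to be refined rather than evaluated. -/
def Refines (k : CovKernel X) (σ : ℝ) (tree : PartitionTree X) (prm : Params) (tr : Trace X)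
    (t : ℕ) : Prop :=
  prm.β * (tr.record t).std k σ tree (tree.pt (tr.sel t)) < prm.V (tr.sel t).1 ∧
    ((tr.sel t).1 : ℝ) ≤ prm.hmax

/-- `tr` is a run of the algorithm, where `resp t v` is the value returned if the node `v` is
evaluated in iteration `t`. The loop ends when the budget is used up or no active node is left;
the state does not change afterwards. Ties in the selection are broken arbitrarily. -/
structure IsRun (k : CovKernel X) (σ : ℝ) (tree : PartitionTree X) (prm : Params)
    (resp : ℕ → Node → ℝ) (tr : Trace X) : Prop where
  active_zero : tr.active 0 = {root}
  record_zero : tr.record 0 = []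
  Shat_zero : tr.Shat 0 = ∅
  Rhat_zero : tr.Rhat 0 = ∅
  /-- the budget is used up -/
  budget_used : ∀ t, prm.n ≤ (tr.record t).length →
    tr.active (t + 1) = tr.active t ∧ tr.record (t + 1) = tr.record t ∧
    tr.Shat (t + 1) = tr.Shat t ∧ tr.Rhat (t + 1) = tr.Rhat t
  /-- cells are accepted -/
  accept : ∀ t, (tr.record t).length < prm.n →
    tr.Shat (t + 1) = tr.Shat t ∪
      ⋃ v ∈ {v | v ∈ tr.active t ∧ prm.τ ≤ tr.lbar k σ tree prm t v}, tree.cell v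
  /-- cells are rejected -/
  reject : ∀ t, (tr.record t).length < prm.n →
    tr.Rhat (t + 1) = tr.Rhat t ∪
      ⋃ v ∈ {v | v ∈ tr.active t ∧ ¬ prm.τ ≤ tr.lbar k σ tree prm t v ∧
        tr.ubar k σ tree prm t v < prm.τ}, tree.cell v
  /-- nothing is left to be explored -/
  exhausted : ∀ t, (tr.record t).length < prm.n → tr.remaining k σ tree prm t = ∅ →
    tr.active (t + 1) = ∅ ∧ tr.record (t + 1) = tr.record t
  /-- a node with the largest index is selected -/
  select : ∀ t, (tr.record t).length < prm.n → (tr.remaining k σ tree prm t).Nonempty →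
    tr.sel t ∈ tr.remaining k σ tree prm t ∧
    ∀ v ∈ tr.remaining k σ tree prm t,
      tr.index k σ tree prm t v ≤ tr.index k σ tree prm t (tr.sel t)
  /-- the selected node is replaced by its children -/
  refine : ∀ t, (tr.record t).length < prm.n → (tr.remaining k σ tree prm t).Nonempty →
    tr.Refines k σ tree prm t →
    tr.active (t + 1) =
      (tr.remaining k σ tree prm t).erase (tr.sel t) ∪
        {leftChild (tr.sel t), rightChild (tr.sel t)} ∧
    tr.record (t + 1) = tr.record t
  /-- the function is evaluated at the selected node -/
  evaluate : ∀ t, (tr.record t).length < prm.n → (tr.remaining k σ tree prm t).Nonempty →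
    ¬ tr.Refines k σ tree prm t →
    tr.active (t + 1) = tr.remaining k σ tree prm t ∧
    tr.record (t + 1) = tr.record t ++ [(tr.sel t, resp t (tr.sel t))]

end Trace

/-! ### Probability -/

/-- `f` is a centred Gaussian process with covariance function `k`. -/
def IsCentredGP {X Ω : Type*} [MeasurableSpace Ω] (k : CovKernel X) (f : X → Ω → ℝ)
    (P : Measure Ω) : Prop :=
  IsGaussianProcess f P ∧ (∀ x, Measurable (f x)) ∧ (∀ x, ∫ ω, f x ω ∂P = 0) ∧
    ∀ x y, cov[f x, f y; P] = k.toFun x y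

/-- `η` is a sequence of independent centred Gaussian variables of variance `σ ^ 2`, independent
of the process `f`. -/
def IsGaussianNoise {X Ω : Type*} [MeasurableSpace Ω] (σ : ℝ) (f : X → Ω → ℝ) (η : ℕ → Ω → ℝ)
    (P : Measure Ω) : Prop :=
  (∀ t, Measurable (η t)) ∧ (∀ t, P.map (η t) = gaussianReal 0 (Real.toNNReal (σ ^ 2))) ∧
    iIndepFun η P ∧ IndepFun (fun ω x => f x ω) (fun ω t => η t ω) P

/-- The sample size `m_h = ⌈2^h log(2^h h_max / δ)⌉`. -/
def sampleSize (hmax δ : ℝ) (h : ℕ) : ℕ :=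
  ⌈(2 : ℝ) ^ h * Real.log ((2 : ℝ) ^ h * hmax / δ)⌉₊

/-- For every depth `h`, given that the number `count h` of evaluations at depth `h` equals `c ≥ 1`,
the points `samples h` are independent and uniformly distributed on the union of the balls of radius
`ε_h = min (v₂ ρ^h, 1 / c)` around the points of depth `h`. -/
def IsUniformSample {X Ω : Type*} [MetricSpace X] [MeasurableSpace X] [MeasurableSpace Ω]
    (tree : PartitionTree X) (vol : Measure X) (P : Measure Ω) (count : ℕ → Ω → ℕ) (m : ℕ → ℕ)
    (samples : ∀ h, Fin (m h) → Ω → X) : Prop :=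
  (∀ h j, Measurable (samples h j)) ∧
  ∀ h c : ℕ, 1 ≤ c → P {ω | count h ω = c} ≠ 0 →
    (P[|{ω | count h ω = c}]).map (fun ω j => samples h j ω) =
      Measure.pi fun _ : Fin (m h) => vol[|tree.neighborhood h c]

end

end LevelSet

/-!
The sum `J_n` is a function of the evaluated points alone, so neither the Gaussian process nor the
noise enters: the only randomness that matters is that of the uniform samples.

*Samples.* The `2 ^ h` balls of radius `ε_h` around the points of depth `h` have equal mass and cover
the sampling region, so a uniform point misses a given one with probability at most `1 - 2⁻ʰ`, and
`m_h` points all miss some ball with probability at most `δ / h_max` (`measure_miss_le`). Evaluated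
nodes have depth at most `⌊h_max⌋ + 1`. At the depths `0` and `1` there are at most two points and
sampling is not needed, so that the union bound runs over `⌊h_max⌋` depths and the total is at
most `δ`.

*Variances.* A posterior variance is the error of the best linear predictor, hence it does not
decrease when one conditions on the evaluations at the same depth only. For these the chain rule
`gainDet_succ` and `v ≤ (σ² + K) log (1 + v / σ²)` bound the sum of the variances by
`(σ² + K) log det (1 + σ⁻² A)`, with `A` the covariance matrix of the evaluated points
(`Record.sumVar_le`).

*Determinants.* Let `w_j` be a sample near the evaluated point `z_j`. Since `f(z)` is the sum of
`f(w)` and `f(z) - f(w)`, the covariance matrix of the `z_j` is at most twice that of the `w_j` plus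
twice that of the increments, whose trace is `∑ d_k(z_j, w_j)² ≤ C_k² n_h^{1 - 2α}`. Splitting the
covariance matrix of the samples at its `T`-th eigenvalue writes the covariance matrix of the `w_j`
as a matrix of rank at most `T` plus one of trace at most `n_h ∑_{i > T} λ̂_i`. The first contributes
`T log (T + 2 n_h K / σ²)` to the logarithm of the determinant, and the others, by concavity of
`log det`, at most their traces (`CovKernel.log_gainDet_le`). For large `n_h` both parts are
dominated by the information term at `s = ⌈n_h / 2⌉`; for bounded `n_h` everything is bounded, the
information term also from below (`CovKernel.log_gainDet_le_infoTerm`).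
-/

open MeasureTheory ProbabilityTheory

namespace LevelSet

/-! ### Determinants of positive semidefinite matrices -/

section Matrix

open Matrix

variable {n m : Type*} [Fintype n] [DecidableEq n] [Fintype m] [DecidableEq m]

theorem posSemidef_exists_eq_conjTranspose_mul_self {A : Matrix n n ℝ} (hA : A.PosSemidef) :
    ∃ B : Matrix n n ℝ, A = Bᴴ * B := by
  open scoped MatrixOrder in
  obtain ⟨B, hB⟩ := CStarAlgebra.nonneg_iff_eq_star_mul_self.mp hA.nonneg
  exact ⟨B, hB⟩

theorem det_le_exp_trace_sub_card {M : Matrix n n ℝ} (hM : M.PosSemidef) :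
    M.det ≤ Real.exp (M.trace - Fintype.card n) := by
  have h : M.trace - Fintype.card n = ∑ i, (hM.1.eigenvalues i - 1) := by
    rw [hM.1.trace_eq_sum_eigenvalues]
    simp
  rw [h, Real.exp_sum, hM.1.det_eq_prod_eigenvalues]
  refine Finset.prod_le_prod (fun i _ => by simpa using hM.eigenvalues_nonneg i) fun i _ => ?_
  have := Real.add_one_le_exp (hM.1.eigenvalues i - 1)
  simpa using this

theorem det_le_trace_pow {M : Matrix n n ℝ} (hM : M.PosSemidef) :
    M.det ≤ M.trace ^ Fintype.card n := by
  rw [hM.1.det_eq_prod_eigenvalues, hM.1.trace_eq_sum_eigenvalues, Fintype.card,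
    ← Finset.prod_const]
  refine Finset.prod_le_prod (fun i _ => by simpa using hM.eigenvalues_nonneg i) fun i _ => ?_
  exact Finset.single_le_sum (f := fun i => ((hM.1.eigenvalues i : ℝ)))
    (fun j _ => hM.eigenvalues_nonneg j) (Finset.mem_univ i)

/-- `(1 + A)⁻¹ ≤ 1` in the Loewner order. -/
theorem posSemidef_one_sub_inv_one_add {A : Matrix n n ℝ} (hA : A.PosSemidef) :
    (1 - (1 + A)⁻¹).PosSemidef := by
  have hP : (1 + A).PosDef := Matrix.PosDef.one.add_posSemidef hA
  have hu : IsUnit (1 + A).det := (Matrix.isUnit_iff_isUnit_det _).1 hP.isUnit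
  have h2 : (A + A ^ 2).PosSemidef := hA.add (hA.pow 2)
  have h3 := h2.mul_mul_conjTranspose_same (1 + A)⁻¹
  rw [hP.inv.isHermitian.eq] at h3
  have h4 : A + A ^ 2 = (1 + A) * (1 + A) - (1 + A) := by noncomm_ring
  rw [h4, Matrix.mul_sub, Matrix.sub_mul, Matrix.nonsing_inv_mul_cancel_left _ _ hu,
    Matrix.mul_nonsing_inv _ hu, Matrix.nonsing_inv_mul _ hu, Matrix.one_mul] at h3
  exact h3

/-- If `Q ≤ 1 + A + R` in the Loewner order, then `log det Q ≤ log det (1 + A) + tr R`: the tangent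
bound for the concave function `log det` at `1 + A`, where `(1 + A)⁻¹ ≤ 1`. -/
theorem det_le_det_one_add_mul_exp_trace {A R Q : Matrix n n ℝ} (hA : A.PosSemidef)
    (hR : R.PosSemidef) (hQ : Q.PosSemidef) (hle : (1 + A + R - Q).PosSemidef) :
    Q.det ≤ (1 + A).det * Real.exp R.trace := by
  have hP : (1 + A).PosDef := Matrix.PosDef.one.add_posSemidef hA
  obtain ⟨B, hB⟩ := posSemidef_exists_eq_conjTranspose_mul_self hP.posSemidef
  have hdet : (1 + A).det = Bᴴ.det * B.det := by rw [hB, det_mul]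
  have hBu : IsUnit B.det := by
    rw [isUnit_iff_ne_zero]
    intro h
    have := hP.det_pos
    rw [hdet, h, mul_zero] at this
    exact this.false
  have hBu' : IsUnit Bᴴ.det := by
    rw [det_conjTranspose]
    exact hBu.star
  set N : Matrix n n ℝ := (B⁻¹)ᴴ * Q * B⁻¹ with hN
  have hNpsd : N.PosSemidef := hQ.conjTranspose_mul_mul_same _
  have hQN : Q = Bᴴ * N * B := by
    rw [hN, conjTranspose_nonsing_inv]
    simp only [Matrix.mul_assoc]
    rw [Matrix.nonsing_inv_mul _ hBu, Matrix.mul_one, Matrix.mul_nonsing_inv_cancel_left _ _ hBu']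
  have hPinv : B⁻¹ * (B⁻¹)ᴴ = (1 + A)⁻¹ := by
    rw [hB, Matrix.mul_inv_rev, conjTranspose_nonsing_inv]
  have htr : N.trace ≤ Fintype.card n + R.trace := by
    have h1 := (hle.conjTranspose_mul_mul_same B⁻¹).trace_nonneg
    rw [Matrix.mul_sub, Matrix.sub_mul, trace_sub, ← hN, Matrix.mul_add, Matrix.add_mul, trace_add,
      hB, conjTranspose_nonsing_inv, Matrix.nonsing_inv_mul_cancel_left _ _ hBu',
      Matrix.mul_nonsing_inv _ hBu, trace_one, ← conjTranspose_nonsing_inv] at h1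
    obtain ⟨E, hE⟩ := posSemidef_exists_eq_conjTranspose_mul_self hR
    have h2 := ((posSemidef_one_sub_inv_one_add hA).mul_mul_conjTranspose_same E).trace_nonneg
    have h3 : ((B⁻¹)ᴴ * R * B⁻¹).trace = (E * (1 + A)⁻¹ * Eᴴ).trace := by
      calc _ = (Eᴴ * E * (B⁻¹ * (B⁻¹)ᴴ)).trace := by
            rw [hE, Matrix.mul_assoc (B⁻¹)ᴴ, Matrix.trace_mul_comm, Matrix.mul_assoc]
        _ = _ := by
            rw [hPinv, Matrix.mul_assoc, Matrix.trace_mul_comm Eᴴ]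
    rw [Matrix.mul_sub, Matrix.sub_mul, trace_sub, Matrix.mul_one, ← h3, Matrix.trace_mul_comm E,
      ← hE] at h2
    linarith
  calc Q.det = Bᴴ.det * B.det * N.det := by rw [hQN, det_mul, det_mul]; ring
    _ = (1 + A).det * N.det := by rw [hdet]
    _ ≤ (1 + A).det * Real.exp R.trace := by
      refine mul_le_mul_of_nonneg_left ?_ hP.det_pos.le
      refine (det_le_exp_trace_sub_card hNpsd).trans (Real.exp_le_exp.2 ?_)
      linarith

/-- A positive semidefinite matrix of low rank, given by a factor `F` with few columns, has a small
determinant after adding the identity. -/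
theorem det_one_add_mul_conjTranspose_le (F : Matrix n m ℝ) :
    (1 + F * Fᴴ).det ≤ (Fintype.card m + (F * Fᴴ).trace) ^ Fintype.card m := by
  rw [det_one_add_mul_comm, Matrix.trace_mul_comm F]
  have h : (1 + Fᴴ * F).PosSemidef :=
    Matrix.PosSemidef.one.add (posSemidef_conjTranspose_mul_self F)
  have := det_le_trace_pow h
  rwa [trace_add, trace_one] at this

end Matrix

/-! ### Posterior variances -/

namespace CovKernel

open Matrix

variable {X : Type*} (k : CovKernel X)

theorem sum_mul_nonneg {ι : Type*} [Fintype ι] (x : ι → X) (c : ι → ℝ) :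
    0 ≤ ∑ i, ∑ j, c i * c j * k.toFun (x i) (x j) := by
  have h := k.posSemidef _ (x ∘ (Fintype.equivFin ι).symm) (c ∘ (Fintype.equivFin ι).symm)
  refine h.trans_eq (Fintype.sum_equiv (Fintype.equivFin ι).symm _ _ fun i => ?_)
  exact Fintype.sum_equiv (Fintype.equivFin ι).symm _ _ fun j => rfl

/-- The covariance matrix of the combinations `s f(z_j) + t f(w_j)`. -/
def combGram {m : ℕ} (z w : Fin m → X) (s t : ℝ) : Matrix (Fin m) (Fin m) ℝ :=
  Matrix.of fun i j => s * s * k.toFun (z i) (z j) + s * t * k.toFun (z i) (w j) +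
    t * s * k.toFun (w i) (z j) + t * t * k.toFun (w i) (w j)

theorem combGram_posSemidef {m : ℕ} (z w : Fin m → X) (s t : ℝ) :
    (k.combGram z w s t).PosSemidef := by
  refine PosSemidef.of_dotProduct_mulVec_nonneg ?_ fun v => ?_
  · ext i j
    simp only [combGram, conjTranspose_apply, of_apply, star_trivial, k.symm (z j) (z i),
      k.symm (z j) (w i), k.symm (w j) (z i), k.symm (w j) (w i)]
    ring
  · have h := k.sum_mul_nonneg (Sum.elim z w) (Sum.elim (fun i => s * v i) (fun i => t * v i))
    refine h.trans_eq ?_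
    simp only [Fintype.sum_sum_type, Sum.elim_inl, Sum.elim_inr, dotProduct, mulVec, combGram,
      of_apply, star_trivial, Finset.mul_sum, ← Finset.sum_add_distrib]
    refine Finset.sum_congr rfl fun i _ => Finset.sum_congr rfl fun j _ => ?_
    ring

theorem gram_posSemidef {m : ℕ} (p : Fin m → X) : (k.gram p).PosSemidef := by
  convert k.combGram_posSemidef p p 1 0
  ext i j
  simp [gram, combGram]

theorem combGram_diag {m : ℕ} (z w : Fin m → X) (i : Fin m) :
    k.combGram z w 1 (-1) i i = k.canonicalDist (z i) (w i) ^ 2 := by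
  have h : k.combGram z w 1 (-1) i i =
      k.toFun (z i) (z i) + k.toFun (w i) (w i) - 2 * k.toFun (z i) (w i) := by
    simp only [combGram, of_apply, k.symm (w i) (z i)]
    ring
  rw [canonicalDist, Real.sq_sqrt, h]
  rw [← h]
  exact (k.combGram_posSemidef z w 1 (-1)).diag_nonneg

variable {σ : ℝ}

theorem gram_add_posDef (hσ : 0 < σ) {m : ℕ} (p : Fin m → X) :
    (k.gram p + σ ^ 2 • (1 : Matrix (Fin m) (Fin m) ℝ)).PosDef :=
  (PosDef.one.smul (pow_pos hσ 2)).posSemidef_add (k.gram_posSemidef p)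

/-- The mean squared error `E (f(x) - ∑ w_i (f(p_i) + η_i))²` of the linear predictor with
weights `w`. -/
noncomputable def linearError (σ : ℝ) {m : ℕ} (p : Fin m → X) (x : X) (w : Fin m → ℝ) : ℝ :=
  k.toFun x x - 2 * ∑ i, w i * k.toFun x (p i) + (∑ i, ∑ j, w i * w j * k.toFun (p i) (p j)) +
    σ ^ 2 * ∑ i, w i * w i

theorem linearError_eq {m : ℕ} (p : Fin m → X) (x : X) (w : Fin m → ℝ) :
    k.linearError σ p x w = k.toFun x x - 2 * (w ⬝ᵥ fun i => k.toFun x (p i)) +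
      w ⬝ᵥ ((k.gram p + σ ^ 2 • (1 : Matrix (Fin m) (Fin m) ℝ)) *ᵥ w) := by
  rw [linearError, add_mulVec, smul_mulVec, one_mulVec, dotProduct_add, dotProduct_smul]
  simp only [dotProduct, mulVec, gram, of_apply, Finset.mul_sum, smul_eq_mul]
  rw [add_assoc]
  congr 2
  refine Finset.sum_congr rfl fun i _ => Finset.sum_congr rfl fun j _ => ?_
  ring

/-- Completing the square: the posterior variance is the error of the best linear predictor. -/
theorem linearError_eq_posteriorVar_add (hσ : 0 < σ) {m : ℕ} (p : Fin m → X) (x : X)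
    (w : Fin m → ℝ) :
    ∃ u : Fin m → ℝ, k.linearError σ p x w = k.posteriorVar σ p x + (w - u) ⬝ᵥ
      ((k.gram p + σ ^ 2 • (1 : Matrix (Fin m) (Fin m) ℝ)) *ᵥ (w - u)) ∧
      k.linearError σ p x u = k.posteriorVar σ p x := by
  have hM := k.gram_add_posDef hσ p
  set M := k.gram p + σ ^ 2 • (1 : Matrix (Fin m) (Fin m) ℝ) with hMdef
  set b : Fin m → ℝ := fun i => k.toFun x (p i) with hb
  have hb' : (fun i => k.toFun (p i) x) = b := by
    ext i
    exact k.symm _ _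
  have hu : M *ᵥ (M⁻¹ *ᵥ b) = b := by
    rw [mulVec_mulVec, Matrix.mul_nonsing_inv _ ((isUnit_iff_isUnit_det _).1 hM.isUnit),
      one_mulVec]
  have hsymm : ∀ v : Fin m → ℝ, (M⁻¹ *ᵥ b) ⬝ᵥ (M *ᵥ v) = b ⬝ᵥ v := by
    intro v
    have hT : Mᵀ = M := by
      have := hM.isHermitian.eq
      rwa [conjTranspose_eq_transpose_of_trivial] at this
    rw [dotProduct_mulVec, ← mulVec_transpose, hT, hu]
  have hvar : k.posteriorVar σ p x = k.toFun x x - b ⬝ᵥ (M⁻¹ *ᵥ b) := by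
    rw [posteriorVar, hb', ← hMdef]
  refine ⟨M⁻¹ *ᵥ b, ?_, ?_⟩
  · rw [linearError_eq, hvar, ← hMdef, mulVec_sub, hu, sub_dotProduct, dotProduct_sub,
      dotProduct_sub, hsymm, dotProduct_comm w b, dotProduct_comm (M⁻¹ *ᵥ b) b]
    ring
  · rw [linearError_eq, hvar, ← hMdef, hu, dotProduct_comm (M⁻¹ *ᵥ b) b]
    ring

theorem posteriorVar_le_linearError (hσ : 0 < σ) {m : ℕ} (p : Fin m → X) (x : X)
    (w : Fin m → ℝ) : k.posteriorVar σ p x ≤ k.linearError σ p x w := by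
  obtain ⟨u, h, -⟩ := k.linearError_eq_posteriorVar_add hσ p x w
  have := (k.gram_add_posDef hσ p).posSemidef.dotProduct_mulVec_nonneg (w - u)
  rw [star_trivial] at this
  linarith

theorem exists_linearError_eq_posteriorVar (hσ : 0 < σ) {m : ℕ} (p : Fin m → X) (x : X) :
    ∃ w, k.linearError σ p x w = k.posteriorVar σ p x :=
  let ⟨u, _, h⟩ := k.linearError_eq_posteriorVar_add hσ p x 0
  ⟨u, h⟩

theorem posteriorVar_le_self (hσ : 0 < σ) {m : ℕ} (p : Fin m → X) (x : X) :
    k.posteriorVar σ p x ≤ k.toFun x x := by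
  simpa [linearError] using k.posteriorVar_le_linearError hσ p x 0

theorem posteriorVar_nonneg (hσ : 0 < σ) {m : ℕ} (p : Fin m → X) (x : X) :
    0 ≤ k.posteriorVar σ p x := by
  obtain ⟨w, hw⟩ := k.exists_linearError_eq_posteriorVar hσ p x
  rw [← hw, linearError]
  have h := k.sum_mul_nonneg (fun o : Option (Fin m) => o.elim x p)
    (fun o => o.elim 1 fun i => -w i)
  simp only [Fintype.sum_option, Option.elim, one_mul, mul_one, neg_mul, mul_neg,
    Finset.sum_neg_distrib, Finset.sum_add_distrib, fun i => k.symm (p i) x] at h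
  have h2 : 0 ≤ σ ^ 2 * ∑ i, w i * w i :=
    mul_nonneg (sq_nonneg _) (Finset.sum_nonneg fun i _ => mul_self_nonneg _)
  linarith

/-- Further observations do not increase the posterior variance. -/
theorem posteriorVar_le_comp (hσ : 0 < σ) {m n : ℕ} (p : Fin m → X) (x : X)
    {e : Fin n → Fin m} (he : Function.Injective e) :
    k.posteriorVar σ p x ≤ k.posteriorVar σ (p ∘ e) x := by
  obtain ⟨w, hw⟩ := k.exists_linearError_eq_posteriorVar hσ (p ∘ e) x
  -- the optimal weights for the smaller set of observations, extended by zero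
  set w' : Fin m → ℝ := Function.extend e w 0 with hw'
  have key : ∀ F : Fin m → ℝ, ∑ i, w' i * F i = ∑ i, w i * F (e i) := by
    intro F
    rw [← Finset.sum_subset (Finset.subset_univ (Finset.univ.image e)),
      Finset.sum_image he.injOn]
    · exact Finset.sum_congr rfl fun i _ => by rw [hw', he.extend_apply]
    · intro i _ hi
      rw [hw', Function.extend_apply', Pi.zero_apply, zero_mul]
      rintro ⟨a, rfl⟩
      exact hi (Finset.mem_image_of_mem e (Finset.mem_univ a))
  have h : k.linearError σ p x w' = k.linearError σ (p ∘ e) x w := by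
    simp only [linearError, mul_assoc, ← Finset.mul_sum, key, Function.comp_apply]
    simp only [hw', he.extend_apply]
  rw [← hw, ← h]
  exact k.posteriorVar_le_linearError hσ p x w'

/-- The determinant `det (1 + σ⁻² (k(p_i, p_j)))`, whose logarithm is twice the mutual information
between the process and its noisy observations at the points `p_i`. -/
noncomputable def gainDet (σ : ℝ) {m : ℕ} (p : Fin m → X) : ℝ :=
  (1 + (σ ^ 2)⁻¹ • k.gram p).det

theorem gainDet_eq (hσ : 0 < σ) {m : ℕ} (p : Fin m → X) :
    k.gainDet σ p = ((σ ^ 2)⁻¹) ^ m * (k.gram p + σ ^ 2 • (1 : Matrix (Fin m) (Fin m) ℝ)).det := by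
  have h : (1 + (σ ^ 2)⁻¹ • k.gram p) =
      (σ ^ 2)⁻¹ • (k.gram p + σ ^ 2 • (1 : Matrix (Fin m) (Fin m) ℝ)) := by
    rw [smul_add, smul_smul, inv_mul_cancel₀ (pow_pos hσ 2).ne', one_smul, add_comm]
  rw [gainDet, h, det_smul, Fintype.card_fin]

theorem gainDet_pos (hσ : 0 < σ) {m : ℕ} (p : Fin m → X) : 0 < k.gainDet σ p := by
  rw [k.gainDet_eq hσ]
  exact mul_pos (pow_pos (inv_pos.2 (pow_pos hσ 2)) _) (k.gram_add_posDef hσ p).det_pos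

/-- The chain rule: a further observation multiplies the determinant by one plus the normalized
posterior variance. -/
theorem gainDet_succ (hσ : 0 < σ) {m : ℕ} (p : Fin (m + 1) → X) :
    k.gainDet σ p = k.gainDet σ (fun i : Fin m => p i.castSucc) *
      (1 + (σ ^ 2)⁻¹ * k.posteriorVar σ (fun i : Fin m => p i.castSucc) (p (Fin.last m))) := by
  have hM := k.gram_add_posDef hσ (fun i : Fin m => p i.castSucc)
  have hσ2 : σ ^ 2 ≠ 0 := (pow_pos hσ 2).ne'
  rw [k.gainDet_eq hσ, k.gainDet_eq hσ, pow_succ]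
  set M := k.gram (fun i : Fin m => p i.castSucc) + σ ^ 2 • (1 : Matrix (Fin m) (Fin m) ℝ)
    with hMdef
  have : Invertible M := hM.isUnit.invertible
  have hblock : (k.gram p + σ ^ 2 • (1 : Matrix (Fin (m + 1)) (Fin (m + 1)) ℝ)).submatrix
      finSumFinEquiv finSumFinEquiv =
      fromBlocks M (Matrix.of fun (i : Fin m) (_ : Fin 1) => k.toFun (p i.castSucc) (p (Fin.last m)))
        (Matrix.of fun (_ : Fin 1) (i : Fin m) => k.toFun (p (Fin.last m)) (p i.castSucc))
        (Matrix.of fun (_ _ : Fin 1) => k.toFun (p (Fin.last m)) (p (Fin.last m)) + σ ^ 2) := by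
    have hlast : Fin.natAdd m (0 : Fin 1) = Fin.last m := rfl
    have hcast : ∀ i : Fin m, Fin.castAdd 1 i = i.castSucc := fun i => rfl
    ext (i | i) (j | j)
    · simp [hMdef, gram, Matrix.one_apply, hcast]
    · fin_cases j
      simp [gram, hlast, hcast, Fin.castSucc_ne_last]
    · fin_cases i
      simp [gram, hlast, hcast, (Fin.castSucc_ne_last _).symm]
    · fin_cases i
      fin_cases j
      simp [gram, hlast]
  rw [← det_submatrix_equiv_self finSumFinEquiv (k.gram p + _), hblock, det_fromBlocks₁₁,
    det_unique (n := Fin 1), invOf_eq_nonsing_inv]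
  have h : (Matrix.of (fun (_ _ : Fin 1) => k.toFun (p (Fin.last m)) (p (Fin.last m)) + σ ^ 2) -
      (Matrix.of fun (_ : Fin 1) (i : Fin m) => k.toFun (p (Fin.last m)) (p i.castSucc)) * M⁻¹ *
      (Matrix.of fun (i : Fin m) (_ : Fin 1) => k.toFun (p i.castSucc) (p (Fin.last m)))) default default =
      σ ^ 2 + k.posteriorVar σ (fun i : Fin m => p i.castSucc) (p (Fin.last m)) := by
    rw [posteriorVar, ← hMdef, Matrix.mul_assoc]
    simp only [Matrix.sub_apply, of_apply, Matrix.mul_apply, dotProduct, mulVec]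
    ring
  rw [h]
  field_simp

/-! ### Information gain and spectral tails -/

theorem tailEigenvalueSum_eq {m : ℕ} (p : Fin m → X) (T : ℕ) :
    k.tailEigenvalueSum p T = ∑ i : Fin m,
      if T ≤ ((Fintype.equivOfCardEq (Fintype.card_fin (Fintype.card (Fin m)))).symm i).1 then
        (k.gram_isHermitian p).eigenvalues i else 0 := by
  rw [tailEigenvalueSum]
  refine Fintype.sum_equiv (Fintype.equivOfCardEq (Fintype.card_fin _)) _ _ fun i => ?_
  simp [IsHermitian.eigenvalues]

theorem tailEigenvalueSum_nonneg {m : ℕ} (p : Fin m → X) (T : ℕ) :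
    0 ≤ k.tailEigenvalueSum p T := by
  rw [tailEigenvalueSum_eq]
  refine Finset.sum_nonneg fun i _ => ?_
  split_ifs
  · exact (k.gram_posSemidef p).eigenvalues_nonneg i
  · exact le_rfl

theorem tailEigenvalueSum_eq_zero {m : ℕ} (p : Fin m → X) {T : ℕ} (h : m ≤ T) :
    k.tailEigenvalueSum p T = 0 := by
  refine Finset.sum_eq_zero fun i _ => if_neg ?_
  have h1 := i.2
  have h2 := Fintype.card_fin m
  omega

/-- The spectral decomposition of the kernel on finitely many points; column `i` of `U` is a unit
eigenvector for the `i`-th eigenvalue, so its entries are at most one in absolute value. -/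
theorem exists_spectral_decomposition {m : ℕ} (p : Fin m → X) :
    ∃ U : Fin m → Fin m → ℝ, (∀ j i, U j i ^ 2 ≤ 1) ∧
      ∀ j l, k.toFun (p j) (p l) =
        ∑ i, (k.gram_isHermitian p).eigenvalues i * (U j i * U l i) := by
  set hG := k.gram_isHermitian p
  refine ⟨fun j i => (hG.eigenvectorUnitary : Matrix (Fin m) (Fin m) ℝ) j i, fun j i => ?_,
    fun j l => ?_⟩
  · have hUU : (hG.eigenvectorUnitary : Matrix (Fin m) (Fin m) ℝ) *
        star (hG.eigenvectorUnitary : Matrix (Fin m) (Fin m) ℝ) = 1 :=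
      Unitary.mul_star_self_of_mem hG.eigenvectorUnitary.2
    have h := congrFun (congrFun hUU j) j
    rw [Matrix.mul_apply, one_apply_eq] at h
    rw [← h]
    have := Finset.single_le_sum (f := fun i =>
      (hG.eigenvectorUnitary : Matrix (Fin m) (Fin m) ℝ) j i *
        (star (hG.eigenvectorUnitary : Matrix (Fin m) (Fin m) ℝ)) i j)
      (fun i _ => by simpa [star_apply] using mul_self_nonneg _) (Finset.mem_univ i)
    refine le_trans (le_of_eq ?_) this
    simp [star_apply, sq]
  · have h := congrFun (congrFun hG.spectral_theorem j) l
    rw [Unitary.conjStarAlgAut_apply, Matrix.mul_apply] at h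
    simp only [mul_diagonal, star_apply, star_trivial, Function.comp_apply] at h
    refine h.trans (Finset.sum_congr rfl fun i _ => ?_)
    simp only [RCLike.ofReal_real_eq_id, id]
    ring

/-- If the points `z` are close to points `w` taken (with repetition) from `p`, then the
information gain at `z` is bounded through the eigenvalues of the covariance matrix of `p`: each of
the first `T` of them contributes logarithmically, and the remaining ones linearly. -/
theorem log_gainDet_le (hσ : 0 < σ) {K : ℝ} (hK : ∀ x, k.toFun x x ≤ K) {c m : ℕ} (z : Fin c → X)
    (p : Fin m → X) (π : Fin c → Fin m) {T : ℕ} (hT : 1 ≤ T) :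
    Real.log (k.gainDet σ z) ≤
      T * Real.log (T + 2 * (σ ^ 2)⁻¹ * (c * K)) +
      2 * (σ ^ 2)⁻¹ * (c * k.tailEigenvalueSum p T +
        ∑ j, k.canonicalDist (z j) (p (π j)) ^ 2) := by
  obtain ⟨U, hU1, hU⟩ := k.exists_spectral_decomposition p
  set ev := (k.gram_isHermitian p).eigenvalues with hev
  have hev0 : ∀ i, 0 ≤ ev i := fun i => (k.gram_posSemidef p).eigenvalues_nonneg i
  set a : ℝ := 2 * (σ ^ 2)⁻¹ with ha
  have ha0 : 0 < a := by positivity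
  set pos : Fin m → ℕ := fun i =>
    ((Fintype.equivOfCardEq (Fintype.card_fin (Fintype.card (Fin m)))).symm i).1 with hpos
  have hposinj : Function.Injective pos := fun i j h =>
    (Fintype.equivOfCardEq (Fintype.card_fin (Fintype.card (Fin m)))).symm.injective (Fin.ext h)
  -- `F` collects the leading eigenvectors, `F'` the remaining ones
  let F : Matrix (Fin c) {i : Fin m // ¬ T ≤ pos i} ℝ :=
    Matrix.of fun j i => Real.sqrt (a * ev i) * U (π j) i
  let F' : Matrix (Fin c) {i : Fin m // T ≤ pos i} ℝ :=
    Matrix.of fun j i => Real.sqrt (a * ev i) * U (π j) i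
  have hsq : ∀ i (s t : ℝ), Real.sqrt (a * ev i) * s * (Real.sqrt (a * ev i) * t) =
      a * (ev i * (s * t)) := by
    intro i s t
    have := Real.mul_self_sqrt (mul_nonneg ha0.le (hev0 i))
    linear_combination (s * t) * this
  have hF : ∀ j l, (F * Fᴴ) j l = ∑ i : {i : Fin m // ¬ T ≤ pos i},
      a * (ev i * (U (π j) i * U (π l) i)) := fun j l => by
    simp only [Matrix.mul_apply, conjTranspose_apply, star_trivial, F, of_apply, hsq]
  have hF' : ∀ j l, (F' * F'ᴴ) j l = ∑ i : {i : Fin m // T ≤ pos i},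
      a * (ev i * (U (π j) i * U (π l) i)) := fun j l => by
    simp only [Matrix.mul_apply, conjTranspose_apply, star_trivial, F', of_apply, hsq]
  have hFF : ∀ j l, (F * Fᴴ) j l + (F' * F'ᴴ) j l = a * k.toFun (p (π j)) (p (π l)) := by
    intro j l
    rw [hF, hF', hU, Finset.mul_sum, add_comm]
    exact Fintype.sum_subtype_add_sum_subtype (fun i => T ≤ pos i)
      fun i => a * (ev i * (U (π j) i * U (π l) i))
  have hnn : ∀ j i, 0 ≤ a * (ev i * (U (π j) i * U (π j) i)) := fun j i =>
    mul_nonneg ha0.le (mul_nonneg (hev0 i) (mul_self_nonneg _))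
  have htrF : (F * Fᴴ).trace ≤ a * (c * K) := by
    have : ∀ j, (F * Fᴴ) j j ≤ a * K := by
      intro j
      have h1 : 0 ≤ (F' * F'ᴴ) j j := by
        rw [hF']
        exact Finset.sum_nonneg fun i _ => hnn j i
      have h2 := hFF j j
      have h3 := mul_le_mul_of_nonneg_left (hK (p (π j))) ha0.le
      linarith
    calc (F * Fᴴ).trace ≤ ∑ _j : Fin c, a * K := Finset.sum_le_sum fun j _ => this j
      _ = a * (c * K) := by simp; ring
  have htrF' : (F' * F'ᴴ).trace ≤ a * (c * k.tailEigenvalueSum p T) := by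
    have : ∀ j, (F' * F'ᴴ) j j ≤ a * k.tailEigenvalueSum p T := by
      intro j
      rw [hF', tailEigenvalueSum_eq, ← Finset.sum_filter, Finset.mul_sum,
        ← Finset.sum_subtype (Finset.univ.filter fun i => T ≤ pos i) (by simp)
          fun i => a * (ev i * (U (π j) i * U (π j) i))]
      refine Finset.sum_le_sum fun i _ => mul_le_mul_of_nonneg_left ?_ ha0.le
      refine mul_le_of_le_one_right (hev0 i) ?_
      rw [← sq]
      exact hU1 _ _
    calc (F' * F'ᴴ).trace ≤ ∑ _j : Fin c, a * k.tailEigenvalueSum p T :=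
          Finset.sum_le_sum fun j _ => this j
      _ = a * (c * k.tailEigenvalueSum p T) := by simp; ring
  set w : Fin c → X := p ∘ π
  set D := k.combGram z w 1 (-1) with hD
  have htrD : (a • D).trace = a * ∑ j, k.canonicalDist (z j) (p (π j)) ^ 2 := by
    rw [trace_smul, smul_eq_mul, trace]
    congr 1
    exact Finset.sum_congr rfl fun j _ => k.combGram_diag z w j
  have hcard : Fintype.card {i : Fin m // ¬ T ≤ pos i} ≤ T := by
    have := Fintype.card_le_of_injective
      (fun i : {i : Fin m // ¬ T ≤ pos i} => (⟨pos i, not_le.1 i.2⟩ : Fin T))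
      fun i j h => Subtype.ext (hposinj (Fin.mk.inj h))
    simpa using this
  -- `f(z) = f(w) + (f(z) - f(w))`, so that the covariance of `f(z)` is at most twice the sum
  -- of the covariances of the two terms
  have hle : (1 + F * Fᴴ + (F' * F'ᴴ + a • D) - (1 + (σ ^ 2)⁻¹ • k.gram z)).PosSemidef := by
    have h := (k.combGram_posSemidef z w (-1) 2).smul (inv_nonneg.2 (sq_nonneg σ))
    convert h using 1
    ext j l
    have h2 := hFF j l
    simp only [Matrix.add_apply, Matrix.sub_apply, Matrix.smul_apply, smul_eq_mul, hD, combGram,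
      gram, of_apply]
    have h3 : k.toFun (w j) (w l) = k.toFun (p (π j)) (p (π l)) := rfl
    rw [h3]
    linear_combination h2
  have hQ : (1 + (σ ^ 2)⁻¹ • k.gram z).PosSemidef :=
    PosSemidef.one.add ((k.gram_posSemidef z).smul (inv_nonneg.2 (sq_nonneg σ)))
  have hA : (F * Fᴴ).PosSemidef := posSemidef_self_mul_conjTranspose F
  have hR : (F' * F'ᴴ + a • D).PosSemidef :=
    (posSemidef_self_mul_conjTranspose F').add ((k.combGram_posSemidef z w 1 (-1)).smul ha0.le)
  have hmain := det_le_det_one_add_mul_exp_trace hA hR hQ hle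
  have hP : 0 < (1 + F * Fᴴ).det := (Matrix.PosDef.one.add_posSemidef hA).det_pos
  have hbase : (1 : ℝ) ≤ T + a * (c * K) := by
    have h1 : (1 : ℝ) ≤ T := by exact_mod_cast hT
    have := hA.trace_nonneg
    linarith
  have hdet : (1 + F * Fᴴ).det ≤ (T + a * (c * K)) ^ T := by
    refine (det_one_add_mul_conjTranspose_le F).trans ?_
    refine (pow_le_pow_left₀ (add_nonneg (Nat.cast_nonneg _) hA.trace_nonneg) ?_ _).trans
      (pow_le_pow_right₀ hbase hcard)
    exact add_le_add (by exact_mod_cast hcard) htrF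
  have hlog := Real.log_le_log (k.gainDet_pos hσ z) hmain
  rw [Real.log_mul hP.ne' (Real.exp_pos _).ne', Real.log_exp, trace_add, htrD] at hlog
  have hlog2 := Real.log_le_log hP hdet
  rw [Real.log_pow] at hlog2
  linarith

end CovKernel

/-! ### From posterior variances to information gain -/

/-- The elementary inequality `v ≤ (s + K) log (1 + v / s)` for `0 ≤ v ≤ K`. -/
theorem le_mul_log_one_add {s K v : ℝ} (hs : 0 < s) (hv : 0 ≤ v) (hvK : v ≤ K) :
    v ≤ (s + K) * Real.log (1 + s⁻¹ * v) := by
  have h1 : 0 < 1 + s⁻¹ * v := by positivity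
  have h2 := Real.one_sub_inv_le_log_of_pos h1
  have h3 : (s + v) * (1 - (1 + s⁻¹ * v)⁻¹) = v := by
    field_simp
    ring
  have h4 : 0 ≤ Real.log (1 + s⁻¹ * v) := Real.log_nonneg (by
    have : 0 ≤ s⁻¹ * v := by positivity
    linarith)
  calc v = (s + v) * (1 - (1 + s⁻¹ * v)⁻¹) := h3.symm
    _ ≤ (s + v) * Real.log (1 + s⁻¹ * v) := mul_le_mul_of_nonneg_left h2 (by linarith)
    _ ≤ _ := mul_le_mul_of_nonneg_right (by linarith) h4

theorem CovKernel.gainDet_comp_cast {X : Type*} (k : CovKernel X) (σ : ℝ) {m n : ℕ} (h : n = m)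
    (p : Fin m → X) : k.gainDet σ (fun i => p (Fin.cast h i)) = k.gainDet σ p := by
  subst h
  rfl

namespace Record

variable {X : Type*} [MetricSpace X] (k : CovKernel X) {σ : ℝ} (tree : PartitionTree X)

/-- The point of the `i`-th evaluation of a record. -/
def point (L : Record) (i : Fin L.length) : X := tree.pt (L.get i).1

/-- The evaluations of a record at points of depth `h`. -/
def atDepth (L : Record) (h : ℕ) : Record := L.filter fun e => e.1.1 = h

theorem length_atDepth (L : Record) (h : ℕ) : (L.atDepth h).length = L.evalCount h :=
  List.countP_eq_length_filter.symm

theorem var_le_self (hσ : 0 < σ) (L : Record) (x : X) : var k σ tree L x ≤ k.toFun x x :=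
  k.posteriorVar_le_self hσ _ x

theorem var_le_of_sublist (hσ : 0 < σ) {L L' : Record} (h : L'.Sublist L) (x : X) :
    var k σ tree L x ≤ var k σ tree L' x := by
  obtain ⟨e, he⟩ := List.sublist_iff_exists_fin_orderEmbedding_get_eq.1 h
  have h2 := k.posteriorVar_le_comp hσ (fun i : Fin L.length => tree.pt (L.get i).1) x e.injective
  refine h2.trans_eq ?_
  unfold var
  congr 1
  ext i
  simp only [Function.comp_apply, he]

theorem gainDet_append (hσ : 0 < σ) (L : Record) (e : Node × ℝ) :
    k.gainDet σ (point tree (L ++ [e])) =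
      k.gainDet σ (point tree L) * (1 + (σ ^ 2)⁻¹ * var k σ tree L (tree.pt e.1)) := by
  have hlen : L.length + 1 = (L ++ [e]).length := by simp
  rw [← k.gainDet_comp_cast σ hlen, k.gainDet_succ hσ]
  have h1 : (fun i : Fin L.length => point tree (L ++ [e]) (Fin.cast hlen i.castSucc)) =
      point tree L := by
    ext i
    simp [point]
  have h2 : point tree (L ++ [e]) (Fin.cast hlen (Fin.last L.length)) = tree.pt e.1 := by
    simp [point]
  rw [h1, h2]
  rfl

theorem sumVar_append (L : Record) (e : Node × ℝ) :
    sumVar k σ tree (L ++ [e]) = sumVar k σ tree L + var k σ tree L (tree.pt e.1) := by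
  have hlen : L.length + 1 = (L ++ [e]).length := by simp
  rw [sumVar, ← Fintype.sum_equiv (finCongr hlen) _ _ fun _ => rfl, Fin.sum_univ_castSucc, sumVar]
  congr 1
  · refine Finset.sum_congr rfl fun i _ => ?_
    simp [List.take_append_of_le_length i.2.le]
  · simp

/-- The sum of the posterior variances is controlled by the information gains of the depths,
since conditioning only on the evaluations at the same depth increases the variances. -/
theorem sumVar_le (hσ : 0 < σ) {K : ℝ} (hK : ∀ x, k.toFun x x ≤ K) (H : ℕ) (L : Record)
    (hL : ∀ e ∈ L, e.1.1 < H) :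
    sumVar k σ tree L ≤
      (σ ^ 2 + K) * ∑ h ∈ Finset.range H, Real.log (k.gainDet σ (point tree (L.atDepth h))) := by
  induction L using List.reverseRecOn with
  | nil =>
    have h0 : ∀ h, Real.log (k.gainDet σ (point tree (atDepth [] h))) = 0 := fun h => by
      have : IsEmpty (Fin (atDepth [] h).length) := inferInstanceAs (IsEmpty (Fin 0))
      rw [CovKernel.gainDet, Matrix.det_isEmpty, Real.log_one]
    simp [h0, sumVar]
  | append_singleton L e ih =>
    have ih := ih fun a ha => hL a (List.mem_append_left _ ha)
    have he : e.1.1 < H := hL e (by simp)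
    set v := var k σ tree (atDepth L e.1.1) (tree.pt e.1) with hv
    have hv0 : 0 ≤ v := k.posteriorVar_nonneg hσ _ _
    have hvK : v ≤ K := (var_le_self k tree hσ _ _).trans (hK _)
    have hle : var k σ tree L (tree.pt e.1) ≤ v :=
      var_le_of_sublist k tree hσ List.filter_sublist _
    have hlog := le_mul_log_one_add (pow_pos hσ 2) hv0 hvK
    have hterm : ∀ h, Real.log (k.gainDet σ (point tree (atDepth (L ++ [e]) h))) =
        Real.log (k.gainDet σ (point tree (atDepth L h))) +
          if e.1.1 = h then Real.log (1 + (σ ^ 2)⁻¹ * v) else 0 := by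
      intro h
      split_ifs with heq
      · have happ : atDepth (L ++ [e]) h = atDepth L h ++ [e] := by
          simp [atDepth, heq]
        rw [happ, gainDet_append k tree hσ, Real.log_mul (k.gainDet_pos hσ _).ne', ← heq]
        rw [← heq, ← hv]
        have : 0 ≤ (σ ^ 2)⁻¹ * v := by positivity
        linarith
      · have happ : atDepth (L ++ [e]) h = atDepth L h := by
          simp [atDepth, heq]
        rw [happ, add_zero]
    rw [sumVar_append, Finset.sum_congr rfl fun h _ => hterm h, Finset.sum_add_distrib,
      Finset.sum_ite_eq, if_pos (Finset.mem_range.2 he), mul_add]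
    linarith

end Record

/-! ### Comparison with the information terms -/

namespace CovKernel

variable {X : Type*} (k : CovKernel X) {σ : ℝ}

theorem le_infoTerm {m : ℕ} (p : Fin m → X) {c T s : ℕ} (hs : 1 ≤ s) (hsc : s ≤ c) :
    (T : ℝ) * Real.log ((s : ℝ) * m / σ ^ 2) +
      (σ ^ 2)⁻¹ * ((c : ℝ) - s) * k.tailEigenvalueSum p T ≤ k.infoTerm σ p c T := by
  have : Finite (Set.Icc 1 c) := (Set.finite_Icc 1 c).to_subtype
  exact le_ciSup (f := fun s : Set.Icc 1 c =>
    ((T : ℝ) * Real.log (((s : ℕ) : ℝ) * (m : ℝ) / σ ^ 2) +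
      (σ ^ 2)⁻¹ * ((c : ℝ) - ((s : ℕ) : ℝ)) * k.tailEigenvalueSum p T))
    (Set.finite_range _).bddAbove ⟨s, hs, hsc⟩

/-- Splitting the evaluations into two halves makes both parts of the information term large. -/
theorem half_le_infoTerm (hσ : 0 < σ) {m : ℕ} (hm : 1 ≤ m) (p : Fin m → X) {c : ℕ} (hc : 2 ≤ c)
    (T : ℕ) :
    (T : ℝ) * Real.log (c / (2 * σ ^ 2)) + (σ ^ 2)⁻¹ * (c / 4) * k.tailEigenvalueSum p T ≤
      k.infoTerm σ p c T := by
  have hσ2 : 0 < σ ^ 2 := pow_pos hσ 2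
  have hs1 : (c : ℝ) ≤ 2 * ((c + 1) / 2 : ℕ) := by
    have : c ≤ 2 * ((c + 1) / 2) := by omega
    exact_mod_cast this
  have hs2 : (((c + 1) / 2 : ℕ) : ℝ) * 2 ≤ c + 1 := by
    have : (c + 1) / 2 * 2 ≤ c + 1 := by omega
    exact_mod_cast this
  have hc' : (2 : ℝ) ≤ c := by exact_mod_cast hc
  have hm' : (1 : ℝ) ≤ m := by exact_mod_cast hm
  refine le_trans ?_ (k.le_infoTerm (s := (c + 1) / 2) p (by omega) (by omega))
  generalize (((c + 1) / 2 : ℕ) : ℝ) = s at *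
  have htail := k.tailEigenvalueSum_nonneg p T
  refine add_le_add (mul_le_mul_of_nonneg_left (Real.log_le_log (by positivity) ?_)
    (Nat.cast_nonneg _)) (mul_le_mul_of_nonneg_right (mul_le_mul_of_nonneg_left (by linarith)
      (inv_nonneg.2 hσ2.le)) htail)
  rw [div_le_div_iff₀ (by positivity) hσ2]
  have : s ≤ s * m := le_mul_of_one_le_right (by linarith) hm'
  nlinarith

theorem neg_le_infoTerm (hσ : 0 < σ) {m : ℕ} (hm : 1 ≤ m) (p : Fin m → X) {c T : ℕ} (hT : 1 ≤ T)
    (hTc : T ≤ c) : -(c * |Real.log (σ ^ 2)|) ≤ k.infoTerm σ p c T := by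
  have hσ2 : 0 < σ ^ 2 := pow_pos hσ 2
  refine le_trans ?_ (k.le_infoTerm (s := c) p (hT.trans hTc) le_rfl)
  rw [sub_self, mul_zero, zero_mul, add_zero]
  have hc' : (1 : ℝ) ≤ c := by exact_mod_cast hT.trans hTc
  have hm' : (1 : ℝ) ≤ m := by exact_mod_cast hm
  have hTc' : (T : ℝ) ≤ c := by exact_mod_cast hTc
  have h1 : -|Real.log (σ ^ 2)| ≤ Real.log (c * m / σ ^ 2) := by
    rw [Real.log_div (by positivity) hσ2.ne']
    have := Real.log_nonneg (one_le_mul_of_one_le_of_one_le hc' hm')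
    have := le_abs_self (Real.log (σ ^ 2))
    linarith
  have h2 := mul_le_mul_of_nonneg_left h1 (Nat.cast_nonneg (α := ℝ) T)
  have h3 := mul_le_mul_of_nonneg_right hTc' (abs_nonneg (Real.log (σ ^ 2)))
  linarith

theorem log_gainDet_le_card_mul (hσ : 0 < σ) {K : ℝ} (hK : ∀ x, k.toFun x x ≤ K) {c : ℕ}
    (z : Fin c → X) : Real.log (k.gainDet σ z) ≤ (σ ^ 2)⁻¹ * (c * K) := by
  have hQ : (1 + (σ ^ 2)⁻¹ • k.gram z).PosSemidef := Matrix.PosSemidef.one.add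
    ((k.gram_posSemidef z).smul (inv_nonneg.2 (sq_nonneg σ)))
  have h := Real.log_le_log (k.gainDet_pos hσ z) (det_le_exp_trace_sub_card hQ)
  rw [Real.log_exp, Matrix.trace_add, Matrix.trace_one, add_sub_cancel_left, Matrix.trace_smul,
    smul_eq_mul] at h
  refine h.trans (mul_le_mul_of_nonneg_left ?_ (inv_nonneg.2 (sq_nonneg σ)))
  calc (k.gram z).trace ≤ ∑ _j : Fin c, K := Finset.sum_le_sum fun j _ => hK (z j)
    _ = c * K := by simp

/-- A number of evaluations from which on `log (c (1 + 2 K / σ²)) ≤ 2 log (c / (2 σ²))` with a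
nonnegative right-hand side, `2 ≤ c` and `1 / c ≤ δ_k`. It depends on `σ`, `K`, `δ_k` only. -/
noncomputable def largeCount (σ K δk : ℝ) : ℝ :=
  4 * σ ^ 2 * σ ^ 2 * (1 + 2 * (σ ^ 2)⁻¹ * K) + 2 + 2 * σ ^ 2 + 1 / δk

theorem log_le_of_largeCount_le (hσ : 0 < σ) {K δk c T : ℝ} (hK : 0 ≤ K) (hδk : 0 < δk)
    (hc : largeCount σ K δk ≤ c) (hT : 0 < T) (hTc : T ≤ c) :
    Real.log (T + 2 * (σ ^ 2)⁻¹ * (c * K)) ≤ 2 * Real.log (c / (2 * σ ^ 2)) := by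
  have hσ2 : 0 < σ ^ 2 := pow_pos hσ 2
  have hδ : 0 < 1 / δk := by positivity
  have hx : 0 ≤ 2 * (σ ^ 2)⁻¹ * K := by positivity
  have hc0 : 0 < c := hT.trans_le hTc
  have h1 : 4 * σ ^ 2 * σ ^ 2 * (1 + 2 * (σ ^ 2)⁻¹ * K) ≤ c := by
    unfold largeCount at hc
    linarith
  rw [← Nat.cast_ofNat (n := 2) (R := ℝ), ← Real.log_pow, Nat.cast_ofNat]
  refine Real.log_le_log (by positivity) ?_
  rw [div_pow, le_div_iff₀ (by positivity)]
  calc (T + 2 * (σ ^ 2)⁻¹ * (c * K)) * (2 * σ ^ 2) ^ 2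
      ≤ (c + 2 * (σ ^ 2)⁻¹ * (c * K)) * (2 * σ ^ 2) ^ 2 := by gcongr
    _ = c * (4 * σ ^ 2 * σ ^ 2 * (1 + 2 * (σ ^ 2)⁻¹ * K)) := by ring
    _ ≤ c ^ 2 := by
      rw [sq c]
      exact mul_le_mul_of_nonneg_left h1 hc0.le

/-- The constant in front of the remainder term. -/
noncomputable def remainderConst (σ K δk Ck : ℝ) : ℝ :=
  largeCount σ K δk * |Real.log (σ ^ 2)| + (σ ^ 2)⁻¹ * (largeCount σ K δk * K) +
    (σ ^ 2)⁻¹ * Ck ^ 2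

/-- The information gain at one depth: `z` are the evaluated points and `p` the sampled ones. Either
the evaluated points are close to sampled ones, or there are at most two different ones. -/
theorem log_gainDet_le_infoTerm (hσ : 0 < σ) {K δk Ck α : ℝ} (hK0 : 0 ≤ K)
    (hK : ∀ x, k.toFun x x ≤ K) (hδk : 0 < δk) {c m T : ℕ} (hm : 1 ≤ m)
    (hT : 1 ≤ T) (hTc : T ≤ c) (z : Fin c → X) (p : Fin m → X)
    (hz : 1 / (c : ℝ) ≤ δk →
      (∃ π : Fin c → Fin m, ∀ j, k.canonicalDist (z j) (p (π j)) ≤ Ck * (1 / (c : ℝ)) ^ α) ∨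
      ∃ (m' : ℕ) (q : Fin m' → X) (π : Fin c → Fin m'), m' ≤ 2 ∧ ∀ j, z j = q (π j)) :
    Real.log (k.gainDet σ z) ≤
      8 * (k.infoTerm σ p c T + remainderConst σ K δk Ck * max 1 ((c : ℝ) ^ (1 - 2 * α))) := by
  have hσ2 : 0 < σ ^ 2 := pow_pos hσ 2
  have hδ : 0 < 1 / δk := by positivity
  have hx : 0 ≤ 4 * σ ^ 2 * σ ^ 2 * (1 + 2 * (σ ^ 2)⁻¹ * K) := by positivity
  have hlc : 0 ≤ largeCount σ K δk := by
    unfold largeCount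
    linarith
  have hmax1 := le_max_left 1 ((c : ℝ) ^ (1 - 2 * α))
  have hmax2 := le_max_right 1 ((c : ℝ) ^ (1 - 2 * α))
  set M := max 1 ((c : ℝ) ^ (1 - 2 * α))
  have hr1 : 0 ≤ largeCount σ K δk * |Real.log (σ ^ 2)| := by positivity
  have hr2 : 0 ≤ (σ ^ 2)⁻¹ * (largeCount σ K δk * K) := by positivity
  have hr3 : 0 ≤ (σ ^ 2)⁻¹ * Ck ^ 2 := by positivity
  have hrem : remainderConst σ K δk Ck = largeCount σ K δk * |Real.log (σ ^ 2)| +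
    (σ ^ 2)⁻¹ * (largeCount σ K δk * K) + (σ ^ 2)⁻¹ * Ck ^ 2 := rfl
  have hrem0 : 0 ≤ remainderConst σ K δk Ck := by linarith
  rcases lt_or_ge (c : ℝ) (largeCount σ K δk) with hc | hc
  · -- few evaluations: all quantities are bounded
    have h1 := k.log_gainDet_le_card_mul hσ hK z
    have h2 := k.neg_le_infoTerm hσ hm p hT hTc
    have h3 : (σ ^ 2)⁻¹ * (c * K) ≤ (σ ^ 2)⁻¹ * (largeCount σ K δk * K) := by gcongr
    have h4 : (c : ℝ) * |Real.log (σ ^ 2)| ≤ largeCount σ K δk * |Real.log (σ ^ 2)| := by gcongr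
    have h5 : remainderConst σ K δk Ck ≤ remainderConst σ K δk Ck * M :=
      le_mul_of_one_le_right hrem0 hmax1
    linarith
  have hc2 : (2 : ℝ) ≤ c := by
    unfold largeCount at hc
    linarith
  have hcσ : 2 * σ ^ 2 ≤ c := by
    unfold largeCount at hc
    linarith
  have hcδ : 1 / (c : ℝ) ≤ δk := by
    rw [one_div_le (by linarith) hδk]
    unfold largeCount at hc
    linarith
  have hlog0 : 0 ≤ Real.log (c / (2 * σ ^ 2)) :=
    Real.log_nonneg ((one_le_div (by positivity)).2 hcσ)
  have hinfo := k.half_le_infoTerm hσ hm p (c := c) (by exact_mod_cast hc2) T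
  have htail := k.tailEigenvalueSum_nonneg p T
  have hT' : (1 : ℝ) ≤ T := by exact_mod_cast hT
  have htail' : 0 ≤ (σ ^ 2)⁻¹ * (c / 4) * k.tailEigenvalueSum p T := by positivity
  have hTlog : Real.log (c / (2 * σ ^ 2)) ≤ T * Real.log (c / (2 * σ ^ 2)) :=
    le_mul_of_one_le_left hlog0 hT'
  have hrM : (σ ^ 2)⁻¹ * Ck ^ 2 * M ≤ remainderConst σ K δk Ck * M :=
    mul_le_mul_of_nonneg_right (by linarith) (by linarith)
  rcases hz hcδ with ⟨π, hπ⟩ | ⟨m', q, π, hm', hq⟩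
  · have h1 := k.log_gainDet_le hσ hK z p π hT
    have h2 := log_le_of_largeCount_le hσ hK0 hδk hc (T := T) (by linarith)
      (by exact_mod_cast hTc)
    have h3 := mul_le_mul_of_nonneg_left h2 (Nat.cast_nonneg (α := ℝ) T)
    have h4 : ∑ j, k.canonicalDist (z j) (p (π j)) ^ 2 ≤ Ck ^ 2 * M := by
      calc ∑ j, k.canonicalDist (z j) (p (π j)) ^ 2
          ≤ ∑ _j : Fin c, (Ck * (1 / (c : ℝ)) ^ α) ^ 2 :=
            Finset.sum_le_sum fun j _ => pow_le_pow_left₀ (Real.sqrt_nonneg _) (hπ j) 2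
        _ = Ck ^ 2 * (c : ℝ) ^ (1 - 2 * α) := by
            have hc0 : (0 : ℝ) < c := by linarith
            rw [Finset.sum_const, Finset.card_univ, Fintype.card_fin, nsmul_eq_mul, mul_pow,
              one_div, Real.inv_rpow hc0.le, Real.rpow_sub hc0, Real.rpow_one, two_mul,
              Real.rpow_add hc0]
            field_simp
        _ ≤ Ck ^ 2 * M := by gcongr
    have h5 : (σ ^ 2)⁻¹ * ∑ j, k.canonicalDist (z j) (p (π j)) ^ 2 ≤ (σ ^ 2)⁻¹ * Ck ^ 2 * M := by
      rw [mul_assoc]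
      gcongr
    have h6 : 0 ≤ (σ ^ 2)⁻¹ * Ck ^ 2 * M := mul_nonneg hr3 (by linarith)
    have h7 : 0 ≤ T * Real.log (c / (2 * σ ^ 2)) := hlog0.trans hTlog
    linarith
  · have h1 := k.log_gainDet_le hσ hK z q π one_le_two
    rw [k.tailEigenvalueSum_eq_zero q hm'] at h1
    have h0 : ∑ j, k.canonicalDist (z j) (q (π j)) ^ 2 = 0 := by
      refine Finset.sum_eq_zero fun j _ => ?_
      rw [hq j, canonicalDist]
      have : k.toFun (q (π j)) (q (π j)) + k.toFun (q (π j)) (q (π j)) -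
        2 * k.toFun (q (π j)) (q (π j)) = 0 := by ring
      rw [this, Real.sqrt_zero, sq, zero_mul]
    have h2 := log_le_of_largeCount_le hσ hK0 hδk hc (T := (2 : ℕ)) (by norm_num)
      (by exact_mod_cast hc2)
    have h6 : 0 ≤ remainderConst σ K δk Ck * M := mul_nonneg hrem0 (by linarith)
    rw [h0, Nat.cast_ofNat] at h1
    rw [Nat.cast_ofNat] at h2
    linarith

end CovKernel

/-! ### Depths reached by the algorithm -/

/-- Only nodes of depth at most `h_max` are refined, so no depth exceeds `⌊h_max⌋ + 1`. -/
theorem Trace.IsRun.depth_lt {X : Type*} [MetricSpace X] {k : CovKernel X} {σ : ℝ}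
    {tree : PartitionTree X} {prm : Params} {resp : ℕ → Node → ℝ} {tr : Trace X}
    (h : tr.IsRun k σ tree prm resp) (t : ℕ) :
    (∀ v ∈ tr.active t, v.1 < ⌊prm.hmax⌋₊ + 2) ∧
      ∀ e ∈ tr.record t, e.1.1 < ⌊prm.hmax⌋₊ + 2 := by
  induction t with
  | zero =>
    rw [h.active_zero, h.record_zero]
    constructor
    · intro v hv
      rw [Finset.mem_singleton] at hv
      subst hv
      exact Nat.succ_pos _
    · simp
  | succ t ih =>
    obtain ⟨ih1, ih2⟩ := ih
    have hrem : ∀ v ∈ tr.remaining k σ tree prm t, v.1 < ⌊prm.hmax⌋₊ + 2 := fun v hv =>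
      ih1 v (Finset.mem_filter.1 hv).1
    rcases le_or_gt prm.n (tr.record t).length with hn | hn
    · obtain ⟨h1, h2, -, -⟩ := h.budget_used t hn
      rw [h1, h2]
      exact ⟨ih1, ih2⟩
    rcases (tr.remaining k σ tree prm t).eq_empty_or_nonempty with he | he
    · obtain ⟨h1, h2⟩ := h.exhausted t hn he
      rw [h1, h2]
      exact ⟨by simp, ih2⟩
    by_cases href : tr.Refines k σ tree prm t
    · obtain ⟨h1, h2⟩ := h.refine t hn he href
      rw [h1, h2]
      refine ⟨fun v hv => ?_, ih2⟩
      have hd : (tr.sel t).1 ≤ ⌊prm.hmax⌋₊ := Nat.le_floor href.2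
      rw [Finset.mem_union, Finset.mem_insert, Finset.mem_singleton] at hv
      rcases hv with hv | rfl | rfl
      · exact hrem v (Finset.mem_of_mem_erase hv)
      · exact Nat.add_lt_add_right (Nat.lt_succ_of_le hd) 1
      · exact Nat.add_lt_add_right (Nat.lt_succ_of_le hd) 1
    · obtain ⟨h1, h2⟩ := h.evaluate t hn he href
      rw [h1, h2]
      refine ⟨hrem, fun e he' => ?_⟩
      rw [List.mem_append, List.mem_singleton] at he'
      rcases he' with he' | rfl
      · exact ih2 e he'
      · exact hrem _ (h.select t hn he).1

/-! ### Random samples hit all balls -/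

theorem PartitionTree.radius_pos {X : Type*} [MetricSpace X] (tree : PartitionTree X) (h : ℕ)
    {c : ℕ} (hc : 1 ≤ c) : 0 < tree.radius h c := by
  have h1 : (0 : ℝ) < c := by exact_mod_cast hc
  have h2 := tree.v₂_pos
  have h3 := tree.ρ_pos
  exact lt_min (by positivity) (by positivity)

theorem measure_neighborhood_ne_zero {X : Type*} [MetricSpace X] [MeasurableSpace X]
    (tree : PartitionTree X) (vol : Measure X) (hvol : tree.BallsEquallyLarge vol)
    (h : ℕ) {c : ℕ} (hc : 1 ≤ c) : vol (tree.neighborhood h c) ≠ 0 := by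
  have i₀ : Fin (2 ^ h) := ⟨0, by positivity⟩
  have h1 := (hvol h _ (tree.radius_pos h hc) (min_le_left _ _) i₀ i₀).1
  exact (h1.trans_le (measure_mono (Set.subset_iUnion (fun i : Fin (2 ^ h) =>
    Metric.ball (tree.pt ⟨h, i⟩) (tree.radius h c)) i₀))).ne'

section Sampling

variable {X : Type*} [MetricSpace X] [MeasurableSpace X] [BorelSpace X]
  (tree : PartitionTree X) (vol : Measure X) [IsFiniteMeasure vol]

theorem measurableSet_neighborhood (h c : ℕ) : MeasurableSet (tree.neighborhood h c) :=
  (isOpen_iUnion fun _ => Metric.isOpen_ball).measurableSet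

/-- The `2 ^ h` balls have equal mass and cover the neighbourhood, so that a uniform point
misses one of them with probability at most `1 - 2⁻ʰ`; they need not be disjoint. -/
theorem cond_compl_ball_le (hvol : tree.BallsEquallyLarge vol) (h : ℕ) {c : ℕ} (hc : 1 ≤ c)
    (i : Fin (2 ^ h)) :
    vol[|tree.neighborhood h c] (Metric.ball (tree.pt ⟨h, i⟩) (tree.radius h c))ᶜ ≤
      ENNReal.ofReal (1 - ((2 : ℝ) ^ h)⁻¹) := by
  set Z := tree.neighborhood h c with hZ
  set B := Metric.ball (tree.pt ⟨h, i⟩) (tree.radius h c) with hB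
  have hZ0 : vol Z ≠ 0 := measure_neighborhood_ne_zero tree vol hvol h hc
  have := cond_isProbabilityMeasure (μ := vol) hZ0
  have hBZ : B ⊆ Z := Set.subset_iUnion (fun i : Fin (2 ^ h) =>
    Metric.ball (tree.pt ⟨h, i⟩) (tree.radius h c)) i
  have hle : vol Z ≤ 2 ^ h * vol B := by
    calc vol Z ≤ ∑ j : Fin (2 ^ h), vol (Metric.ball (tree.pt ⟨h, j⟩) (tree.radius h c)) :=
          measure_iUnion_fintype_le vol _
      _ = ∑ _j : Fin (2 ^ h), vol B := Finset.sum_congr rfl fun j _ =>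
          (hvol h _ (tree.radius_pos h hc) (min_le_left _ _) j i).2
      _ = 2 ^ h * vol B := by simp
  have h1 : (2 ^ h : ENNReal)⁻¹ ≤ vol[|Z] B := by
    rw [cond_apply (measurableSet_neighborhood tree h c), Set.inter_eq_self_of_subset_right hBZ,
      mul_comm, ← div_eq_mul_inv, ENNReal.le_div_iff_mul_le (Or.inl hZ0)
        (Or.inl (measure_ne_top _ _)), mul_comm, ← div_eq_mul_inv]
    exact ENNReal.div_le_of_le_mul' hle
  rw [prob_compl_eq_one_sub Metric.isOpen_ball.measurableSet,
    ENNReal.ofReal_sub _ (by positivity), ENNReal.ofReal_one,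
    ENNReal.ofReal_inv_of_pos (by positivity), ENNReal.ofReal_pow (by norm_num)]
  simpa using tsub_le_tsub_left h1 1

/-- The configurations of `m` samples that miss at least one of the balls of radius `ε_h` around
the points of depth `h`. -/
def missSet (h c m : ℕ) : Set (Fin m → X) :=
  ⋃ i : Fin (2 ^ h), Set.univ.pi fun _ =>
    (Metric.ball (tree.pt ⟨h, i⟩) (tree.radius h c))ᶜ

theorem measurableSet_missSet (h c m : ℕ) : MeasurableSet (missSet tree h c m) :=
  MeasurableSet.iUnion fun _ => MeasurableSet.univ_pi fun _ =>
    Metric.isOpen_ball.measurableSet.compl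

theorem sampleSize_pos {hmax δ : ℝ} (hmax1 : 1 ≤ hmax) (hδ0 : 0 < δ) (hδ1 : δ < 1) (h : ℕ) :
    1 ≤ sampleSize hmax δ h := by
  have h1 : (1 : ℝ) ≤ 2 ^ h * hmax :=
    one_le_mul_of_one_le_of_one_le (one_le_pow₀ one_le_two) hmax1
  refine Nat.ceil_pos.2 (mul_pos (by positivity) (Real.log_pos ?_))
  rw [one_lt_div hδ0]
  linarith

theorem pow_mul_one_sub_pow_sampleSize_le {hmax δ : ℝ} (hmax1 : 1 ≤ hmax) (hδ0 : 0 < δ) (h : ℕ) :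
    (2 : ℝ) ^ h * (1 - ((2 : ℝ) ^ h)⁻¹) ^ sampleSize hmax δ h ≤ δ / hmax := by
  have hpow : (1 : ℝ) ≤ 2 ^ h := one_le_pow₀ one_le_two
  have hm : (2 : ℝ) ^ h * Real.log ((2 : ℝ) ^ h * hmax / δ) ≤ sampleSize hmax δ h :=
    Nat.le_ceil _
  have h0 : 0 ≤ 1 - ((2 : ℝ) ^ h)⁻¹ := sub_nonneg.2 (inv_le_one_of_one_le₀ hpow)
  have h1 : (1 - ((2 : ℝ) ^ h)⁻¹) ^ sampleSize hmax δ h ≤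
      ((2 : ℝ) ^ h * hmax / δ)⁻¹ := by
    calc (1 - ((2 : ℝ) ^ h)⁻¹) ^ sampleSize hmax δ h
        ≤ Real.exp (-((2 : ℝ) ^ h)⁻¹) ^ sampleSize hmax δ h :=
          pow_le_pow_left₀ h0 (Real.one_sub_le_exp_neg _) _
      _ = Real.exp (-(((2 : ℝ) ^ h)⁻¹ * sampleSize hmax δ h)) := by
          rw [← Real.exp_nat_mul]
          congr 1
          ring
      _ ≤ Real.exp (-Real.log ((2 : ℝ) ^ h * hmax / δ)) := by
          refine Real.exp_le_exp.2 (neg_le_neg ?_)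
          rw [inv_mul_eq_div, le_div_iff₀ (by positivity), mul_comm]
          exact hm
      _ = _ := by rw [Real.exp_neg, Real.exp_log (by positivity)]
  calc _ ≤ (2 : ℝ) ^ h * ((2 : ℝ) ^ h * hmax / δ)⁻¹ :=
        mul_le_mul_of_nonneg_left h1 (by positivity)
    _ = δ / hmax := by field_simp

theorem pi_missSet_le (hvol : tree.BallsEquallyLarge vol) {hmax δ : ℝ} (hmax1 : 1 ≤ hmax)
    (hδ0 : 0 < δ) (h : ℕ) {c : ℕ} (hc : 1 ≤ c) :
    (Measure.pi fun _ : Fin (sampleSize hmax δ h) => vol[|tree.neighborhood h c])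
      (missSet tree h c (sampleSize hmax δ h)) ≤ ENNReal.ofReal (δ / hmax) := by
  have := cond_isProbabilityMeasure (μ := vol) (measure_neighborhood_ne_zero tree vol hvol h hc)
  have h0 : 0 ≤ 1 - ((2 : ℝ) ^ h)⁻¹ :=
    sub_nonneg.2 (inv_le_one_of_one_le₀ (one_le_pow₀ one_le_two))
  calc _ ≤ ∑ i : Fin (2 ^ h), (Measure.pi fun _ : Fin (sampleSize hmax δ h) =>
            vol[|tree.neighborhood h c]) (Set.univ.pi fun _ =>
              (Metric.ball (tree.pt ⟨h, i⟩) (tree.radius h c))ᶜ) :=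
        measure_iUnion_fintype_le _ _
    _ ≤ ∑ _i : Fin (2 ^ h), ENNReal.ofReal (1 - ((2 : ℝ) ^ h)⁻¹) ^ sampleSize hmax δ h := by
        refine Finset.sum_le_sum fun i _ => ?_
        rw [Measure.pi_pi, Finset.prod_const, Finset.card_univ, Fintype.card_fin]
        exact pow_le_pow_left' (cond_compl_ball_le tree vol hvol h hc i) _
    _ = ENNReal.ofReal ((2 : ℝ) ^ h * (1 - ((2 : ℝ) ^ h)⁻¹) ^ sampleSize hmax δ h) := by
        rw [ENNReal.ofReal_mul (by positivity), ENNReal.ofReal_pow h0,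
          ENNReal.ofReal_pow (by norm_num)]
        simp
    _ ≤ _ := ENNReal.ofReal_le_ofReal (pow_mul_one_sub_pow_sampleSize_le hmax1 hδ0 h)

/-- The event that some ball around a point of depth `h` contains none of the samples has
probability at most `δ / h_max`, by conditioning on the number of evaluations. -/
theorem measure_miss_le (hvol : tree.BallsEquallyLarge vol) {hmax δ : ℝ} (hmax1 : 1 ≤ hmax)
    (hδ0 : 0 < δ) {Ω : Type*} [MeasurableSpace Ω] (P : Measure Ω) [IsProbabilityMeasure P]
    {count : ℕ → Ω → ℕ} (hcount : ∀ h, Measurable (count h))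
    {samples : ∀ h, Fin (sampleSize hmax δ h) → Ω → X}
    (hs : IsUniformSample tree vol P count (sampleSize hmax δ) samples) (h : ℕ) :
    P {ω | 1 ≤ count h ω ∧ (fun j => samples h j ω) ∈ missSet tree h (count h ω) _} ≤
      ENNReal.ofReal (δ / hmax) := by
  set E := {ω | 1 ≤ count h ω ∧ (fun j => samples h j ω) ∈ missSet tree h (count h ω) _}
  have hA : ∀ c, MeasurableSet {ω | count h ω = c} := fun c => hcount h (measurableSet_singleton c)
  have hcover : E ⊆ ⋃ c, E ∩ {ω | count h ω = c} := fun ω hω => Set.mem_iUnion.2 ⟨_, hω, rfl⟩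
  have hterm : ∀ c, P (E ∩ {ω | count h ω = c}) ≤
      ENNReal.ofReal (δ / hmax) * P {ω | count h ω = c} := by
    intro c
    rcases Nat.eq_zero_or_pos c with rfl | hc
    · have : E ∩ {ω | count h ω = 0} = ∅ := by
        ext ω
        simp only [E, Set.mem_inter_iff, Set.mem_ofPred_eq, Set.mem_empty_iff_false, iff_false]
        omega
      simp [this]
    rcases eq_or_ne (P {ω | count h ω = c}) 0 with h0 | h0
    · exact (measure_mono Set.inter_subset_right).trans (by simp [h0])
    have hmeas : Measurable fun ω j => samples h j ω := measurable_pi_lambda _ (hs.1 h)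
    have hsub : E ∩ {ω | count h ω = c} ⊆ {ω | count h ω = c} ∩
        (fun ω j => samples h j ω) ⁻¹' missSet tree h c _ := by
      rintro ω ⟨hω, rfl⟩
      exact ⟨rfl, hω.2⟩
    refine (measure_mono hsub).trans ?_
    rw [← cond_mul_eq_inter (hA c), ← Measure.map_apply hmeas (measurableSet_missSet tree h c _),
      hs.2 h c hc h0]
    gcongr
    exact pi_missSet_le tree vol hvol hmax1 hδ0 h hc
  calc P E ≤ ∑' c, P (E ∩ {ω | count h ω = c}) :=
        (measure_mono hcover).trans (measure_iUnion_le _)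
    _ ≤ ∑' c, ENNReal.ofReal (δ / hmax) * P {ω | count h ω = c} := ENNReal.tsum_le_tsum hterm
    _ = ENNReal.ofReal (δ / hmax) * P (⋃ c, {ω | count h ω = c}) := by
        rw [ENNReal.tsum_mul_left, measure_iUnion _ hA]
        intro c d hcd
        exact Set.disjoint_left.2 fun ω h1 h2 => hcd (h1.symm.trans h2)
    _ ≤ ENNReal.ofReal (δ / hmax) := mul_le_of_le_one_right' prob_le_one

end Sampling

/-! ### The bound on the sum of the posterior variances -/

/-- The deterministic part: it suffices that the samples at the depths `h ≥ 2` hit all the balls. -/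
theorem sumVar_le_of_not_mem_missSet {X : Type*} [MetricSpace X] {σ K δk Ck α δ : ℝ}
    (hσ : 0 < σ) (hK0 : 0 ≤ K) (hδk : 0 < δk) (hCk : 0 < Ck) (hα : 0 < α) (k : CovKernel X)
    (hK : ∀ x, k.toFun x x ≤ K) {g : ℝ → ℝ} (hg : ∀ x y, k.canonicalDist x y ≤ g (dist x y))
    (hgC : ∀ r, 0 ≤ r → r ≤ δk → g r ≤ Ck * r ^ α) (tree : PartitionTree X) {hmax : ℝ}
    (hmax1 : 1 ≤ hmax) (hδ0 : 0 < δ) (hδ1 : δ < 1) (L : Record) {H : ℕ}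
    (hL : ∀ e ∈ L, e.1.1 < H) (p : ∀ h, Fin (sampleSize hmax δ h) → X)
    (hp : ∀ h ∈ Finset.Ico 2 H, 1 ≤ L.evalCount h → p h ∉ missSet tree h (L.evalCount h) _)
    (T : ℕ → ℕ) (hT : ∀ h, 1 ≤ L.evalCount h → 1 ≤ T h ∧ T h ≤ L.evalCount h) :
    L.sumVar k σ tree ≤ 8 * (σ ^ 2 + K) *
      ∑ h ∈ (Finset.range H).filter (fun h => 1 ≤ L.evalCount h),
        (k.infoTerm σ (p h) (L.evalCount h) (T h) +
          CovKernel.remainderConst σ K δk Ck * max 1 ((L.evalCount h : ℝ) ^ (1 - 2 * α))) := by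
  refine (Record.sumVar_le k tree hσ hK H L hL).trans ?_
  rw [mul_comm 8, mul_assoc]
  refine mul_le_mul_of_nonneg_left ?_ (by positivity)
  rw [Finset.mul_sum, Finset.sum_filter]
  refine Finset.sum_le_sum fun h hh => ?_
  split_ifs with hc
  · have hlen := Record.length_atDepth L h
    have hdepth : ∀ j : Fin (L.atDepth h).length, ∃ i : Fin (2 ^ h),
        ((L.atDepth h).get j).1 = ⟨h, i⟩ := by
      intro j
      have hmem := List.get_mem (L.atDepth h) j
      have h1 := (List.mem_filter.1 hmem).2
      generalize (Record.atDepth L h).get j = e at h1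
      obtain ⟨⟨d, i⟩, y⟩ := e
      obtain rfl : d = h := by simpa using h1
      exact ⟨i, rfl⟩
    choose node hnode using hdepth
    rw [← hlen]
    refine k.log_gainDet_le_infoTerm hσ hK0 hK hδk (sampleSize_pos hmax1 hδ0 hδ1 h) (hT h hc).1
      (hlen ▸ (hT h hc).2) _ _ fun hsmall => ?_
    rcases Nat.lt_or_ge h 2 with h2 | h2
    · -- at depths `0` and `1` there are at most two points, and no sampling is needed
      refine Or.inr ⟨2 ^ h, fun i => tree.pt ⟨h, i⟩, node, ?_, fun j => ?_⟩
      · interval_cases h <;> norm_num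
      · rw [Record.point, hnode]
    · left
      have hhit : ∀ i : Fin (2 ^ h), ∃ j, p h j ∈
          Metric.ball (tree.pt ⟨h, i⟩) (tree.radius h (L.evalCount h)) := by
        intro i
        have := hp h (Finset.mem_Ico.2 ⟨h2, Finset.mem_range.1 hh⟩) hc
        by_contra! hcon
        exact this (Set.mem_iUnion.2 ⟨i, fun j _ => hcon j⟩)
      choose near hnear using hhit
      refine ⟨fun j => near (node j), fun j => ?_⟩
      rw [Record.point, hnode]
      have hd : dist (tree.pt ⟨h, node j⟩) (p h (near (node j))) ≤
          1 / ((L.atDepth h).length : ℝ) := by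
        have h1 := Metric.mem_ball'.1 (hnear (node j))
        rw [hlen]
        exact h1.le.trans (min_le_right _ _)
      calc _ ≤ g (dist (tree.pt ⟨h, node j⟩) (p h (near (node j)))) := hg _ _
        _ ≤ Ck * dist (tree.pt ⟨h, node j⟩) (p h (near (node j))) ^ α :=
          hgC _ dist_nonneg (hd.trans hsmall)
        _ ≤ _ := mul_le_mul_of_nonneg_left
          (Real.rpow_le_rpow dist_nonneg hd hα.le) hCk.le
  · have h0 : (L.atDepth h).length = 0 := by
      rw [Record.length_atDepth]
      omega
    have : IsEmpty (Fin (L.atDepth h).length) := by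
      rw [h0]
      infer_instance
    rw [CovKernel.gainDet, Matrix.det_isEmpty, Real.log_one]

end LevelSet

theorem theorem2 (σ K δk Ck α : ℝ) (hσ : 0 < σ) (hδk : 0 < δk) (hCk : 0 < Ck)
    (hα_pos : 0 < α) (hα_le : α ≤ 1) :
    ∃ C₁ C₂ : ℝ, 0 < C₁ ∧ 0 < C₂ ∧
      ∀ {X : Type*} [MetricSpace X] [CompactSpace X] [MeasurableSpace X] [BorelSpace X]
        (k : LevelSet.CovKernel X) (_ : ∀ x, k.toFun x x ≤ K)
        (g : ℝ → ℝ) (_ : MonotoneOn g (Set.Ici 0)) (_ : ContinuousOn g (Set.Ici 0)) (_ : g 0 = 0)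
        (_ : ∀ x y : X, k.canonicalDist x y ≤ g (dist x y))
        (_ : ∀ r : ℝ, 0 ≤ r → r ≤ δk → g r ≤ Ck * r ^ α)
        (tree : LevelSet.PartitionTree X) (vol : MeasureTheory.Measure X)
        [MeasureTheory.IsFiniteMeasure vol] (_ : tree.BallsEquallyLarge vol)
        (prm : LevelSet.Params) (_ : 1 ≤ prm.hmax) (δ : ℝ) (_ : 0 < δ) (_ : δ < 1)
        {Ω : Type*} [MeasurableSpace Ω] (P : MeasureTheory.Measure Ω)
        [MeasureTheory.IsProbabilityMeasure P]
        (f : X → Ω → ℝ) (_ : LevelSet.IsCentredGP k f P)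
        (η : ℕ → Ω → ℝ) (_ : LevelSet.IsGaussianNoise σ f η P)
        (run : Ω → LevelSet.Trace X)
        (_ : ∀ ω, (run ω).IsRun k σ tree prm (fun t v => f (tree.pt v) ω + η t ω))
        -- the state after `N` iterations; for large `N` it is the final state of the algorithm
        (N : ℕ)
        (_ : ∀ h, Measurable fun ω => ((run ω).record N).evalCount h)
        (samples : ∀ h, Fin (LevelSet.sampleSize prm.hmax δ h) → Ω → X)
        (_ : LevelSet.IsUniformSample tree vol P (fun h ω => ((run ω).record N).evalCount h)
          (LevelSet.sampleSize prm.hmax δ) samples),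
        ENNReal.ofReal (1 - δ) ≤ P {ω |
          ∀ T : ℕ → ℕ,
            (∀ h, 1 ≤ ((run ω).record N).evalCount h →
              1 ≤ T h ∧ T h ≤ ((run ω).record N).evalCount h) →
            ((run ω).record N).sumVar k σ tree ≤
              C₁ * ∑ h ∈ (Finset.range (⌊prm.hmax⌋₊ + 2)).filter
                  (fun h => 1 ≤ ((run ω).record N).evalCount h),
                (k.infoTerm σ (fun j => samples h j ω) (((run ω).record N).evalCount h) (T h) +
                  C₂ * max 1 ((((run ω).record N).evalCount h : ℝ) ^ (1 - 2 * α)))} := by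
  have hK0 : 0 ≤ max K 0 := le_max_right _ _
  have hlc : 0 ≤ LevelSet.CovKernel.largeCount σ (max K 0) δk := by
    unfold LevelSet.CovKernel.largeCount
    positivity
  refine ⟨8 * (σ ^ 2 + max K 0), LevelSet.CovKernel.remainderConst σ (max K 0) δk Ck,
    by positivity, ?_, ?_⟩
  · unfold LevelSet.CovKernel.remainderConst
    positivity
  intro X _ _ _ _ k hK g _ _ _ hg hgC tree vol _ hvol prm hmax1 δ hδ0 hδ1 Ω _ P _ f _ η _ run hrun
    N hcount samples hs
  set H := ⌊prm.hmax⌋₊ + 2 with hH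
  set count : ℕ → Ω → ℕ := fun h ω => ((run ω).record N).evalCount h with hcountdef
  set bad : ℕ → Set Ω := fun h => {ω | 1 ≤ count h ω ∧
    (fun j => samples h j ω) ∈ LevelSet.missSet tree h (count h ω) _} with hbad
  have hbadP : P (⋃ h ∈ Finset.Ico 2 H, bad h) ≤ ENNReal.ofReal δ := by
    calc P (⋃ h ∈ Finset.Ico 2 H, bad h) ≤ ∑ h ∈ Finset.Ico 2 H, P (bad h) :=
          MeasureTheory.measure_biUnion_finset_le _ _
      _ ≤ ∑ _h ∈ Finset.Ico 2 H, ENNReal.ofReal (δ / prm.hmax) := Finset.sum_le_sum fun h _ =>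
          LevelSet.measure_miss_le tree vol hvol hmax1 hδ0 P hcount hs h
      _ = ENNReal.ofReal (⌊prm.hmax⌋₊ * (δ / prm.hmax)) := by
          rw [Finset.sum_const, Nat.card_Ico, nsmul_eq_mul,
            ENNReal.ofReal_mul (Nat.cast_nonneg _), ENNReal.ofReal_natCast, hH, Nat.add_sub_cancel]
      _ ≤ ENNReal.ofReal δ := by
          refine ENNReal.ofReal_le_ofReal ?_
          have h1 := Nat.floor_le (zero_le_one.trans hmax1)
          rw [mul_div_assoc', div_le_iff₀ (by linarith), mul_comm]
          exact mul_le_mul_of_nonneg_left h1 hδ0.le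
  -- the good event need not be measurable, so its outer measure is bounded through the cover
  -- of the whole space by the good and the bad event
  set good := {ω | ∀ T : ℕ → ℕ,
    (∀ h, 1 ≤ ((run ω).record N).evalCount h →
      1 ≤ T h ∧ T h ≤ ((run ω).record N).evalCount h) →
    ((run ω).record N).sumVar k σ tree ≤
      8 * (σ ^ 2 + max K 0) * ∑ h ∈ (Finset.range H).filter
          (fun h => 1 ≤ ((run ω).record N).evalCount h),
        (k.infoTerm σ (fun j => samples h j ω) (((run ω).record N).evalCount h) (T h) +
          LevelSet.CovKernel.remainderConst σ (max K 0) δk Ck *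
            max 1 ((((run ω).record N).evalCount h : ℝ) ^ (1 - 2 * α)))} with hgood
  have hcover : Set.univ ⊆ good ∪ ⋃ h ∈ Finset.Ico 2 H, bad h := by
    intro ω _
    by_cases hω : ω ∈ ⋃ h ∈ Finset.Ico 2 H, bad h
    · exact Or.inr hω
    refine Or.inl fun T hT => ?_
    refine LevelSet.sumVar_le_of_not_mem_missSet hσ hK0 hδk hCk hα_pos k
      (fun x => (hK x).trans (le_max_left _ _)) hg hgC tree hmax1 hδ0 hδ1 _
      ((hrun ω).depth_lt N).2 (fun h j => samples h j ω) (fun h hh hc hmiss => hω ?_) T hT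
    exact Set.mem_biUnion hh ⟨hc, hmiss⟩
  have htotal : 1 ≤ P good + ENNReal.ofReal δ := by
    calc (1 : ENNReal) = P Set.univ := MeasureTheory.measure_univ.symm
      _ ≤ P good + P (⋃ h ∈ Finset.Ico 2 H, bad h) :=
        (MeasureTheory.measure_mono hcover).trans (MeasureTheory.measure_union_le _ _)
      _ ≤ _ := add_le_add_right hbadP _
  rw [ENNReal.ofReal_sub _ hδ0.le, ENNReal.ofReal_one]
  exact tsub_le_iff_right.2 htotal
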